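/- **Setting.** Write $x=(x^0,\mathbf x)\in\mathbb R^4$. A *free field* with $d$ components and $r$ spin indices is given by a mass $m\ge 0$ and amplitudes $u^a_s,v^a_s$ ($1\le s\le r$, $1\le a\le d$), functions on $\mathbb R^3$ which are multipliers of its scalar single particle space $E_m$; here $E_m=\mathcal S(\mathbb R^3)$ if $m>0$, and $E_0=\mathcal S^0(\mathbb R^3)$ is the closed subspace of $\mathcal S(\mathbb R^3)$ of the functions all of whose derivatives vanish at $0$ (a multiplier is a function whose multiplication operator maps the space continuously into itself). If $m=0$, then moreover $|u^a_s(\mathbf p)||v^b_s(\mathbf p)|\le C/|\mathbf p|$ for $0<|\mathbf p|\le 1$. Its plane wave kernels, and those with regularized energy, are $$\kappa_{\epsilon\,0,1}(s,\mathbf p;a,x)=u^a_s(\mathbf p)\,e^{-i(p_0x^0-\mathbf p\cdot\mathbf x)},\qquad \kappa_{\epsilon\,1,0}(s,\mathbf p;a,x)=v^a_s(\mathbf p)\,e^{i(p_0x^0-\mathbf p\cdot\mathbf x)},$$ with $p_0=(|\mathbf p|^2+m^2)^{1/2}$ if $m>0$ and $p_0=(|\mathbf p|^2+\epsilon^2)^{1/2}$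 if $m=0$; for $\epsilon=0$ they are denoted $\kappa_{0,1},\kappa_{1,0}$. So only the kernels of massless fields depend on $\epsilon$, and only through the energy in the exponent. Let $q',n_1,n_2\ge0$ be integers, put $q=n_1+n_2+2q'$, and let $A_1,\dots,A_{q'}$ (the contracted fields), $F_1,\dots,F_{n_1}$ (non-contracted, at $x$) and $G_1,\dots,G_{n_2}$ (non-contracted, at $y$) be free fields with $d$ components and $r$ spin indices. Let $E^{\otimes(q-2q')}$ be the completed tensor product of the single particle spaces of the $F_i$ and $G_j$, that is, the space of the Schwartz functions $\xi$ of $n_1+n_2$ momenta in $\mathbb R^3$, with values $(\xi(s,\mathbf p))_s$ indexed by the $n_1+n_2$ spin indices, all of whose derivatives vanish where the momentum of some massless field is zero. The contraction of $A_1,\dots,A_{q'}$, with components $a$ at $x$ and $b$ at $y$, is the distribution in $x-y$ with $$\langle D^{ab},\phi\rangle=\sum_{s}\int d\mathbf p\int dx\ \prod_k \kappa^{(A_k)}_{0,1}(s_k,\mathbf p_k;a_k,x)\,\kappa^{(A_k)}_{1,0}(s_k,\mathbf p_k;b_k,0)\,\phi(x).$$ A *retarded part* of $D$ is a tempered distribution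 $R\in\mathcal S'(\mathbb R^4)$ for which there are $N\in\mathbb N$, a cutoff $w\in\mathcal S(\mathbb R^4)$ equal to $1$ near $0$, and a linear combination $L$ of the derivatives of order $\le N$ of $\delta$, such that for all $\phi\in\mathcal S(\mathbb R^4)$ $$\langle R,\phi\rangle=\langle D,\theta\,\Omega'\phi\rangle+\langle L,\phi\rangle,\qquad \Omega'\phi=\phi-\sum_{|\alpha|\le N}D^\alpha\phi(0)\,\tfrac{x^\alpha}{\alpha!}\,w,$$ where $\theta$ is the unit step function of $x^0$, and $\langle D,\theta\,\Omega'\phi\rangle$ means $\lim_{\tau\to\infty}\langle D,\theta_\tau\,\Omega'\phi\rangle$ with $\theta_\tau(x)=h(\tau x^0)$, for a fixed smooth step $h$ equal to $0$ on $(-\infty,0]$ and to $1$ on $[1,\infty)$. Let $T=(T^{ab}(x,y))$ be $\mathrm{ret}$ of the contraction, that is, $T^{ab}(x,y)=R^{ab}(x-y)$ where $R^{ab}$ is a retarded part of $D^{ab}$. **Statement.** For $\epsilon\ge 0$ let $\kappa_\epsilon$ be the contraction kernel in which only the non-contracted massless plane wave kernels are replaced by their massive counterparts, $$\kappa_\epsilon=T\times\Big[\big(\kappa^{(F_1)}_{\epsilon\,0,1}\dot\otimes\cdots\dot\otimes\kappa^{(F_{n_1})}_{\epsilon\,0,1}\big)\otimes\big(\kappa^{(G_1)}_{\epsilon\,1,0}\dot\otimes\cdots\dot\otimes\kappa^{(G_{n_2})}_{\epsilon\,1,0}\big)\Big].$$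 That is, for $\xi\in E^{\otimes(q-2q')}$ and for the components $a,b$ of the non-contracted fields, let $W^{ab}_\epsilon(\xi)(x,y)$ be the sum over $s$ and the integral over $\mathbf p$ of $\prod_i\kappa^{(F_i)}_{\epsilon\,0,1}(s_i,\mathbf p_i;a_i,x)\prod_j\kappa^{(G_j)}_{\epsilon\,1,0}(s_j,\mathbf p_j;b_j,y)\,\xi(s,\mathbf p)$; then $\kappa_\epsilon(\xi)$ is the tempered distribution with components $W^{ab}_\epsilon(\xi)\,T^{a'b'}$. Put $\kappa=\kappa_0$. Let $\mathscr E$ denote the spaces of Schwartz test functions on $\mathbb R^4$ with the components that occur at $x$, respectively at $y$. 1. The integrals defining $W^{ab}_\epsilon(\xi)$ converge absolutely, and $W^{ab}_\epsilon(\xi)$ is smooth and all its derivatives are polynomially bounded, so that the product $W^{ab}_\epsilon(\xi)\,T^{a'b'}$ is defined; and $\kappa_\epsilon$ belongs to $\mathscr L(E^{\otimes(q-2q')},(\mathscr E^{\otimes2})^*)$, where $(\mathscr E^{\otimes 2})^*$ is the strong dual of the completed tensor product $\mathscr E^{\otimes 2}$ of the two test function spaces, for every $\epsilon\ge0$. 2.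 $\kappa_\epsilon\to\kappa$ in $\mathscr L(E^{\otimes(q-2q')},(\mathscr E^{\otimes2})^*)$, with the topology of uniform convergence on bounded sets, as $\epsilon\to0^+$. 3. There are $k,i\in\mathbb N$ such that for every $\epsilon_0>0$ there is a finite $c$ with $$\big|\langle\kappa_\epsilon(\phi\otimes\varphi)-\kappa(\phi\otimes\varphi),\xi\rangle\big|\le\epsilon\,c\,|\phi|_k\,|\varphi|_k\,|\xi|_i$$ for all $0<\epsilon\le\epsilon_0$, all test functions $\phi$ (of $x$) and $\varphi$ (of $y$) in $\mathscr E$ and all $\xi\in E^{\otimes(q-2q')}$, where $|f|_k=\max_{j,l\le k}\sup_x|x|^j|D^lf(x)|$ are the Schwartz norms, and $\langle\kappa_\epsilon(\phi\otimes\varphi),\xi\rangle=\langle\kappa_\epsilon(\xi),\phi\otimes\varphi\rangle$. All this remains true if $T$ is replaced by any tempered distribution on $\mathbb R^4\times\mathbb R^4$, with any finite numbers of components at $x$ and at $y$. -/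

import Mathlib

open scoped SchwartzMap Topology

noncomputable section

namespace PlaneWave

/-! ### Momentum space, space-time and the nuclear spaces -/

/-- Spatial momentum space `ℝ³`. -/
abbrev Momentum : Type := EuclideanSpace ℝ (Fin 3)

/-- Space-time `ℝ⁴`; the coordinate `0` is the time. -/
abbrev SpaceTime : Type := EuclideanSpace ℝ (Fin 4)

/-- The Minkowski product `p · x = p⁰ x⁰ - 𝐩 · 𝐱` of the four-momentum `(e, 𝐩)` with `x`. -/
def minkowski (e : ℝ) (p : Momentum) (x : SpaceTime) : ℝ :=
  e * x 0 - ∑ j : Fin 3, p j * x j.succ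

/-- The (scalar) single particle space of a field of mass `m`: the space `𝓢(ℝ³)` if `m ≠ 0`, and
the closed subspace `𝓢⁰(ℝ³)` of the functions all of whose derivatives vanish at zero if `m = 0`. -/
def singleParticleSpace (m : ℝ) : Submodule ℂ 𝓢(Momentum, ℂ) where
  carrier := {f | m = 0 → ∀ n : ℕ, iteratedFDeriv ℝ n f 0 = 0}
  zero_mem' := by
    intro _ n
    have h : ((0 : 𝓢(Momentum, ℂ)) : Momentum → ℂ) = 0 := by ext x; simp
    rw [h, iteratedFDeriv_zero]; rfl
  add_mem' := by
    intro f g hf hg hm n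
    have h : ((f + g : 𝓢(Momentum, ℂ)) : Momentum → ℂ) = ⇑f + ⇑g := by ext x; simp
    rw [h, iteratedFDeriv_add_apply (f.smooth n).contDiffAt (g.smooth n).contDiffAt,
      hf hm n, hg hm n, add_zero]
  smul_mem' := by
    intro c f hf hm n
    have h : ((c • f : 𝓢(Momentum, ℂ)) : Momentum → ℂ) = c • ⇑f := by ext x; simp
    rw [h, iteratedFDeriv_const_smul_apply (f.smooth n).contDiffAt, hf hm n, smul_zero]

/-- The tensor product of the single particle spaces of fields with masses `m i` and spin indices in
`Fin r`, realized as a space of functions of all spin-momentum variables: the Schwartz functions on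
`(ℝ³)^ι` with values `(ξ(s, p))_s`, all of whose derivatives vanish wherever the momentum of
some massless field is zero. It carries the topology induced by the Schwartz space. -/
def tensorSpace {ι : Type} [Fintype ι] [DecidableEq ι] (r : ℕ) (m : ι → ℝ) :
    Submodule ℂ 𝓢(ι → Momentum, (ι → Fin r) → ℂ) where
  carrier := {ξ | ∀ i, m i = 0 → ∀ (n : ℕ) (p : ι → Momentum), p i = 0 →
    iteratedFDeriv ℝ n ξ p = 0}
  zero_mem' := by
    intro i _ n p _
    have h : ((0 : 𝓢(ι → Momentum, (ι → Fin r) → ℂ)) : (ι → Momentum) → (ι → Fin r) → ℂ) = 0 := by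
      ext x; simp
    rw [h, iteratedFDeriv_zero]; rfl
  add_mem' := by
    intro f g hf hg i hm n p hp
    have h : ((f + g : 𝓢(ι → Momentum, (ι → Fin r) → ℂ)) : (ι → Momentum) → (ι → Fin r) → ℂ)
        = ⇑f + ⇑g := by ext x; simp
    rw [h, iteratedFDeriv_add_apply (f.smooth n).contDiffAt (g.smooth n).contDiffAt,
      hf i hm n p hp, hg i hm n p hp, add_zero]
  smul_mem' := by
    intro c f hf i hm n p hp
    have h : ((c • f : 𝓢(ι → Momentum, (ι → Fin r) → ℂ)) : (ι → Momentum) → (ι → Fin r) → ℂ)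
        = c • ⇑f := by ext x; simp
    rw [h, iteratedFDeriv_const_smul_apply (f.smooth n).contDiffAt, hf i hm n p hp, smul_zero]

/-- `u` is a multiplier of the space of test functions `S`: multiplication by `u` is a continuous
operator of `S` into itself. -/
def IsMultiplier (S : Submodule ℂ 𝓢(Momentum, ℂ)) (u : Momentum → ℂ) : Prop :=
  ∃ A : S →L[ℂ] S, ∀ (f : S) (p : Momentum), (A f : 𝓢(Momentum, ℂ)) p = u p * (f : 𝓢(Momentum, ℂ)) p

/-! ### Plane wave kernels of free fields -/

/-- The data of the plane wave kernels
`κ₀₁(s, 𝐩; a, x) = u_s^a(𝐩) e^{-i p·x}` and `κ₁₀(s, 𝐩; a, x) = v_s^a(𝐩) e^{i p·x}`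
of a free field with `d` components, with spin index `s` in `Fin r`. The amplitudes are
multipliers of the single particle space, and for a massless field the products of the annihilation
and creation amplitudes have at most the singularity `1 / |𝐩|` at zero. -/
structure FreeField (r d : ℕ) where
  mass : ℝ
  mass_nonneg : 0 ≤ mass
  u : Fin r → Fin d → Momentum → ℂ
  v : Fin r → Fin d → Momentum → ℂ
  u_multiplier : ∀ s a, IsMultiplier (singleParticleSpace mass) (u s a)
  v_multiplier : ∀ s a, IsMultiplier (singleParticleSpace mass) (v s a)
  infrared : mass = 0 → ∃ C : ℝ, ∀ s a b p, 0 < ‖p‖ → ‖p‖ ≤ 1 →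
    ‖u s a p‖ * ‖v s b p‖ ≤ C / ‖p‖

variable {r d : ℕ}

/-- The energy in the exponents of the kernels: `(|𝐩|² + m²)^{1/2}` for a massive field, and
`(|𝐩|² + ε²)^{1/2}` for a massless one. For `ε = 0` these are the original energies. -/
def FreeField.energy (A : FreeField r d) (ε : ℝ) (p : Momentum) : ℝ :=
  if A.mass = 0 then √(‖p‖ ^ 2 + ε ^ 2) else √(‖p‖ ^ 2 + A.mass ^ 2)

/-- The kernel `κ_{ε 0,1}(s, 𝐩; a, x)`; it is `κ_{0,1}` if the field is massive or if `ε = 0`. -/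
def FreeField.kernel01 (A : FreeField r d) (ε : ℝ) (s : Fin r) (p : Momentum) (a : Fin d)
    (x : SpaceTime) : ℂ :=
  A.u s a p * Complex.exp (-(Complex.I * (minkowski (A.energy ε p) p x : ℂ)))

/-- The kernel `κ_{ε 1,0}(s, 𝐩; a, x)`; it is `κ_{1,0}` if the field is massive or if `ε = 0`. -/
def FreeField.kernel10 (A : FreeField r d) (ε : ℝ) (s : Fin r) (p : Momentum) (a : Fin d)
    (x : SpaceTime) : ℂ :=
  A.v s a p * Complex.exp (Complex.I * (minkowski (A.energy ε p) p x : ℂ))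

/-! ### Tensor products of test functions -/

section Tensor

variable {D₁ D₂ E F G : Type*}
  [NormedAddCommGroup D₁] [NormedSpace ℝ D₁] [NormedAddCommGroup D₂] [NormedSpace ℝ D₂]
  [NormedAddCommGroup E] [NormedSpace ℝ E] [NormedAddCommGroup F] [NormedSpace ℝ F]
  [NormedAddCommGroup G] [NormedSpace ℝ G]

/-- The function `(x, y) ↦ B (f x) (g y)`, for a continuous bilinear map `B`. -/
def tensor (B : E →L[ℝ] F →L[ℝ] G) (f : 𝓢(D₁, E)) (g : 𝓢(D₂, F)) : 𝓢(D₁ × D₂, G) where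
  toFun z := B (f z.1) (g z.2)
  smooth' := by
    have hf := (f.smooth ⊤).comp (contDiff_fst (𝕜 := ℝ) (E := D₁) (F := D₂))
    have hg := (g.smooth ⊤).comp (contDiff_snd (𝕜 := ℝ) (E := D₁) (F := D₂))
    exact (B.contDiff.comp hf).clm_apply hg
  decay' := by
    intro k n
    have hf := (f.smooth ⊤).comp (contDiff_fst (𝕜 := ℝ) (E := D₁) (F := D₂))
    have hg := (g.smooth ⊤).comp (contDiff_snd (𝕜 := ℝ) (E := D₁) (F := D₂))
    choose Cf hCf using fun q : ℕ × ℕ => f.decay q.1 q.2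
    choose Cg hCg using fun q : ℕ × ℕ => g.decay q.1 q.2
    have hdf : ∀ (i : ℕ) (z : D₁ × D₂),
        ‖iteratedFDeriv ℝ i (⇑f ∘ Prod.fst) z‖ ≤ ‖iteratedFDeriv ℝ i f z.1‖ := by
      intro i z
      have h := (ContinuousLinearMap.fst ℝ D₁ D₂).iteratedFDeriv_comp_right (f.smooth ⊤) z
        (i := i) (by exact_mod_cast le_top)
      have h' : iteratedFDeriv ℝ i (⇑f ∘ Prod.fst) z =
          (iteratedFDeriv ℝ i f z.1).compContinuousLinearMap
            fun _ => ContinuousLinearMap.fst ℝ D₁ D₂ := h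
      rw [h']
      refine (ContinuousMultilinearMap.norm_compContinuousLinearMap_le _ _).trans ?_
      refine mul_le_of_le_one_right (norm_nonneg _) ?_
      exact Finset.prod_le_one (fun _ _ => norm_nonneg _)
        (fun _ _ => ContinuousLinearMap.norm_fst_le _ _ _)
    have hdg : ∀ (i : ℕ) (z : D₁ × D₂),
        ‖iteratedFDeriv ℝ i (⇑g ∘ Prod.snd) z‖ ≤ ‖iteratedFDeriv ℝ i g z.2‖ := by
      intro i z
      have h := (ContinuousLinearMap.snd ℝ D₁ D₂).iteratedFDeriv_comp_right (g.smooth ⊤) z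
        (i := i) (by exact_mod_cast le_top)
      have h' : iteratedFDeriv ℝ i (⇑g ∘ Prod.snd) z =
          (iteratedFDeriv ℝ i g z.2).compContinuousLinearMap
            fun _ => ContinuousLinearMap.snd ℝ D₁ D₂ := h
      rw [h']
      refine (ContinuousMultilinearMap.norm_compContinuousLinearMap_le _ _).trans ?_
      refine mul_le_of_le_one_right (norm_nonneg _) ?_
      exact Finset.prod_le_one (fun _ _ => norm_nonneg _)
        (fun _ _ => ContinuousLinearMap.norm_snd_le _ _ _)
    refine ⟨‖B‖ * ∑ i ∈ Finset.range (n + 1), (n.choose i : ℝ) *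
      (Cf (k, i) * Cg (0, n - i) + Cf (0, i) * Cg (k, n - i)), fun z => ?_⟩
    have hB := B.norm_iteratedFDeriv_le_of_bilinear hf hg z (n := n) (by exact_mod_cast le_top)
    have hz : ‖z‖ ^ k ≤ ‖z.1‖ ^ k + ‖z.2‖ ^ k := by
      rw [Prod.norm_def]
      rcases le_total ‖z.1‖ ‖z.2‖ with h | h
      · rw [max_eq_right h]; exact le_add_of_nonneg_left (by positivity)
      · rw [max_eq_left h]; exact le_add_of_nonneg_right (by positivity)
    refine (mul_le_mul_of_nonneg_left hB (by positivity)).trans ?_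
    rw [mul_left_comm]
    refine mul_le_mul_of_nonneg_left ?_ B.opNorm_nonneg
    rw [Finset.mul_sum]
    refine Finset.sum_le_sum fun i _ => ?_
    have h1 := (hCf (k, i)).2 z.1
    have h2 := (hCg (0, n - i)).2 z.2
    have h3 := (hCf (0, i)).2 z.1
    have h4 := (hCg (k, n - i)).2 z.2
    simp only [pow_zero, one_mul] at h2 h3
    have e1 := hdf i z
    have e2 := hdg (n - i) z
    calc ‖z‖ ^ k * ((n.choose i : ℝ) * ‖iteratedFDeriv ℝ i (⇑f ∘ Prod.fst) z‖ *
          ‖iteratedFDeriv ℝ (n - i) (⇑g ∘ Prod.snd) z‖)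
        ≤ (‖z.1‖ ^ k + ‖z.2‖ ^ k) * ((n.choose i : ℝ) * ‖iteratedFDeriv ℝ i f z.1‖ *
          ‖iteratedFDeriv ℝ (n - i) g z.2‖) := by gcongr
      _ = (n.choose i : ℝ) * ((‖z.1‖ ^ k * ‖iteratedFDeriv ℝ i f z.1‖) *
            ‖iteratedFDeriv ℝ (n - i) g z.2‖ + ‖iteratedFDeriv ℝ i f z.1‖ *
            (‖z.2‖ ^ k * ‖iteratedFDeriv ℝ (n - i) g z.2‖)) := by ring
      _ ≤ _ := by
        gcongr
        · exact (by positivity : (0:ℝ) ≤ _).trans h1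
        · exact (by positivity : (0:ℝ) ≤ _).trans h3

end Tensor

/-- `(φ ⊗ ϕ)(x, y) = φ(x) ϕ(y)` for scalar test functions. -/
def scalarTensor (φ ϕ : 𝓢(SpaceTime, ℂ)) : 𝓢(SpaceTime × SpaceTime, ℂ) :=
  tensor (ContinuousLinearMap.mul ℝ ℂ) φ ϕ

/-- The bilinear map `(a, b) ↦ (a_i b_j)_{(i,j)}`. -/
def outer (I J : Type) [Fintype I] [Fintype J] : (I → ℂ) →L[ℝ] (J → ℂ) →L[ℝ] (I × J → ℂ) :=
  LinearMap.toContinuousBilinearMap <|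
    LinearMap.mk₂ ℝ (fun (a : I → ℂ) (b : J → ℂ) (q : I × J) => a q.1 * b q.2)
      (fun _ _ _ => by ext; simp [add_mul])
      (fun _ _ _ => by ext; simp [mul_assoc])
      (fun _ _ _ => by ext; simp [mul_add])
      (fun _ _ _ => by ext; simp [mul_left_comm])

/-- `(φ ⊗ ϕ)^{ij}(x, y) = φ^i(x) ϕ^j(y)` for test functions with several components. -/
def componentTensor {I J : Type} [Fintype I] [Fintype J] (φ : 𝓢(SpaceTime, I → ℂ))
    (ϕ : 𝓢(SpaceTime, J → ℂ)) : 𝓢(SpaceTime × SpaceTime, I × J → ℂ) :=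
  tensor (outer I J) φ ϕ

/-- The norms `max_{j, l ≤ k} sup_x |x|^j |D^l φ(x)|` defining the Schwartz topology. -/
def schwartzNorm {D V : Type*} [NormedAddCommGroup D] [NormedSpace ℝ D] [NormedAddCommGroup V]
    [NormedSpace ℂ V] [NormedSpace ℝ V] [SMulCommClass ℝ ℂ V] (k : ℕ) : Seminorm ℂ 𝓢(D, V) :=
  (Finset.Iic (k, k)).sup (schwartzSeminormFamily ℂ D V)

/-! ### Contractions and their retarded parts -/

/-- The contraction `(κ⁽¹⁾₀₁ ⊗̇ … ⊗̇ κ⁽ᵗ⁾₀₁) ⊗_t (κ⁽¹⁾₁₀ ⊗̇ … ⊗̇ κ⁽ᵗ⁾₁₀)` over all spin-momentum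
variables (the product of `t` pairing functions), as a distribution in the difference `x - y` of
the space-time variables. Here `a` and `b` are the components at `x` and at `y`. -/
def contraction {t : ℕ} (A : Fin t → FreeField r d) (a b : Fin t → Fin d)
    (φ : 𝓢(SpaceTime, ℂ)) : ℂ :=
  ∑ s : Fin t → Fin r, ∫ p : Fin t → Momentum, ∫ x : SpaceTime,
    (∏ k, (A k).kernel01 0 (s k) (p k) (a k) x) *
      (∏ k, (A k).kernel10 0 (s k) (p k) (b k) 0) * φ x

/-- The operator `Ω'` of order `ω`, which subtracts from `φ` its Taylor polynomial of degree `ω` at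
zero multiplied by the cutoff `w`: `Ω'φ = φ - ∑_{|α| ≤ ω} D^α φ(0) (x^α / α!) w`. -/
def taylorSubtract (ω : ℕ) (w φ : 𝓢(SpaceTime, ℂ)) : 𝓢(SpaceTime, ℂ) :=
  φ - SchwartzMap.smulLeftCLM ℂ (fun x : SpaceTime =>
    ∑ n ∈ Finset.range (ω + 1), ((n.factorial : ℂ))⁻¹ * iteratedFDeriv ℝ n φ 0 (fun _ => x)) w

/-- `R` is a retarded part of `κ`: for some order `ω` and some cutoff `w` equal to one near zero,
`⟨R, φ⟩ = ⟨κ, θ Ω'φ⟩` up to a linear combination of the derivatives of order at most `ω` of the Dirac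
distribution. The pairing of `κ` with the discontinuous function `θ Ω'φ`, where `θ` is the unit step
function of the time `x⁰`, is the limit of its pairings with `θ_τ Ω'φ`, where `θ_τ` are smooth steps
tending to `θ`, equal to `0` for `x⁰ ≤ 0` and to `1` for `x⁰ ≥ 1 / τ`. -/
def IsRetardedPart (κ : 𝓢(SpaceTime, ℂ) → ℂ) (R : 𝓢'(SpaceTime, ℂ)) : Prop :=
  ∃ (ω : ℕ) (w : 𝓢(SpaceTime, ℂ)) (C : (n : ℕ) → (Fin n → Fin 4) → ℂ),
    (∀ᶠ x in 𝓝 (0 : SpaceTime), w x = 1) ∧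
    ∀ φ : 𝓢(SpaceTime, ℂ),
      Filter.Tendsto
        (fun τ : ℝ => κ (SchwartzMap.smulLeftCLM ℂ
          (fun x : SpaceTime => ((Real.smoothTransition (τ * x 0) : ℝ) : ℂ))
          (taylorSubtract ω w φ)))
        Filter.atTop
        (𝓝 (R φ - ∑ n ∈ Finset.range (ω + 1), ∑ μ : Fin n → Fin 4,
          C n μ * iteratedFDeriv ℝ n φ 0 (fun i => EuclideanSpace.single (μ i) (1 : ℝ))))

/-- The automorphism `(x, y) ↦ (x - y, y)` of `ℝ⁴ × ℝ⁴`. -/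
def shear : (SpaceTime × SpaceTime) ≃L[ℝ] (SpaceTime × SpaceTime) :=
  ContinuousLinearEquiv.equivOfInverse
    ((ContinuousLinearMap.fst ℝ SpaceTime SpaceTime -
      ContinuousLinearMap.snd ℝ SpaceTime SpaceTime).prod
        (ContinuousLinearMap.snd ℝ SpaceTime SpaceTime))
    ((ContinuousLinearMap.fst ℝ SpaceTime SpaceTime +
      ContinuousLinearMap.snd ℝ SpaceTime SpaceTime).prod
        (ContinuousLinearMap.snd ℝ SpaceTime SpaceTime))
    (fun z => by ext <;> simp) (fun z => by ext <;> simp)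

/-- `T` is the distribution `ret[(κ⁽¹⁾₀₁ ⊗̇ … ⊗̇ κ⁽ᵗ⁾₀₁) ⊗_t (κ⁽¹⁾₁₀ ⊗̇ … ⊗̇ κ⁽ᵗ⁾₁₀)](x, y)`: each of its
components is the translation invariant distribution `R(x - y)`, given on the test functions
`φ(x - y) ϕ(y)` by `⟨R, φ⟩ ∫ ϕ`, with `R` a retarded part of the contraction. -/
def IsRetardedContraction {t : ℕ} (A : Fin t → FreeField r d)
    (T : (Fin t → Fin d) × (Fin t → Fin d) → 𝓢'(SpaceTime × SpaceTime, ℂ)) : Prop :=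
  ∀ ab, ∃ R : 𝓢'(SpaceTime, ℂ), IsRetardedPart (contraction A ab.1 ab.2) R ∧
    ∀ φ ϕ : 𝓢(SpaceTime, ℂ),
      T ab (SchwartzMap.compCLMOfContinuousLinearEquiv ℂ shear (scalarTensor φ ϕ)) =
        R φ * ∫ y, ϕ y

/-! ### The non contracted kernels and the full kernel -/

section NonContracted

variable {n₁ n₂ : ℕ}

/-- The masses of the non contracted fields, those at `x` and those at `y`. -/
def masses (F : Fin n₁ → FreeField r d) (G : Fin n₂ → FreeField r d) : Fin n₁ ⊕ Fin n₂ → ℝ :=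
  Sum.elim (fun i => (F i).mass) (fun j => (G j).mass)

/-- The tensor product of the single particle spaces of all non contracted fields. -/
abbrev ParticleSpace (F : Fin n₁ → FreeField r d) (G : Fin n₂ → FreeField r d) : Type :=
  tensorSpace r (masses F G)

/-- The integrand
`∏_i κ⁽ⁱ⁾_{ε 0,1}(s_i, p_i; a_i, x) ∏_j κ⁽ʲ⁾_{ε 1,0}(s_j, p_j; b_j, y) ξ(s, p)`. -/
def waveIntegrand (ε : ℝ) (F : Fin n₁ → FreeField r d) (G : Fin n₂ → FreeField r d)
    (a : Fin n₁ → Fin d) (b : Fin n₂ → Fin d) (ξ : ParticleSpace F G)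
    (z : SpaceTime × SpaceTime) (s : Fin n₁ ⊕ Fin n₂ → Fin r)
    (p : Fin n₁ ⊕ Fin n₂ → Momentum) : ℂ :=
  (∏ i, (F i).kernel01 ε (s (.inl i)) (p (.inl i)) (a i) z.1) *
    (∏ j, (G j).kernel10 ε (s (.inr j)) (p (.inr j)) (b j) z.2) *
    (ξ : 𝓢(Fin n₁ ⊕ Fin n₂ → Momentum, (Fin n₁ ⊕ Fin n₂ → Fin r) → ℂ)) p s

/-- The value at `ξ` of the kernel
`(κ⁽¹⁾_{ε 0,1} ⊗̇ … ⊗̇ κ⁽ⁿ¹⁾_{ε 0,1}) ⊗ (κ⁽¹⁾_{ε 1,0} ⊗̇ … ⊗̇ κ⁽ⁿ²⁾_{ε 1,0})`, a function of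
`z = (x, y)`. -/
def waveProduct (ε : ℝ) (F : Fin n₁ → FreeField r d) (G : Fin n₂ → FreeField r d)
    (a : Fin n₁ → Fin d) (b : Fin n₂ → Fin d) (ξ : ParticleSpace F G)
    (z : SpaceTime × SpaceTime) : ℂ :=
  ∑ s : Fin n₁ ⊕ Fin n₂ → Fin r, ∫ p : Fin n₁ ⊕ Fin n₂ → Momentum,
    waveIntegrand ε F G a b ξ z s p

/-- The component indices of the test functions in `x` (or in `y`): an index in `I` for the
distributional factor, and an index for each of the `n` non contracted fields. -/
abbrev Components (I : Type) (n d : ℕ) : Type := I × (Fin n → Fin d)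

/-- The test functions `𝓔 ⊗ 𝓔` of two space-time variables. -/
abbrev TestSpace (I J : Type) [Fintype I] [Fintype J] (n₁ n₂ d : ℕ) : Type :=
  𝓢(SpaceTime × SpaceTime, Components I n₁ d × Components J n₂ d → ℂ)

variable {I J : Type} [Fintype I] [Fintype J]

/-- `κ` is the kernel `T · [(κ⁽¹⁾_{ε 0,1} ⊗̇ … ⊗̇ κ⁽ⁿ¹⁾_{ε 0,1}) ⊗ (κ⁽¹⁾_{ε 1,0} ⊗̇ … ⊗̇ κ⁽ⁿ²⁾_{ε 1,0})]`,
as a continuous linear map into the space of distributions with its strong dual topology: the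
integrals which define the value at `ξ` of the product of the plane wave kernels converge
absolutely, this value is a multiplier of the Schwartz space, and `κ(ξ)` is the product of this
multiplier and the distribution `T`. -/
def IsProductKernel (ε : ℝ) (F : Fin n₁ → FreeField r d) (G : Fin n₂ → FreeField r d)
    (T : I × J → 𝓢'(SpaceTime × SpaceTime, ℂ))
    (κ : ParticleSpace F G →L[ℂ] (TestSpace I J n₁ n₂ d →L[ℂ] ℂ)) : Prop :=
  ∀ ξ : ParticleSpace F G,
    (∀ a b z s, MeasureTheory.Integrable (waveIntegrand ε F G a b ξ z s)) ∧
    (∀ a b, (waveProduct ε F G a b ξ).HasTemperateGrowth) ∧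
    ∀ χ : TestSpace I J n₁ n₂ d,
      κ ξ χ = ∑ i : Components I n₁ d, ∑ j : Components J n₂ d,
        TemperedDistribution.smulLeftCLM ℂ (waveProduct ε F G i.2 j.2 ξ) (T (i.1, j.1))
          (SchwartzMap.postcompCLM
            (ContinuousLinearMap.proj (R := ℂ) (φ := fun _ => ℂ) (i, j)) χ)

/-- The product kernels `κ_ε` and `κ = κ_0` with the distributional factor `T` exist as continuous
linear maps, `κ_ε → κ` as `ε → 0⁺` uniformly on bounded sets, and
`|⟨κ_ε(φ ⊗ ϕ) - κ(φ ⊗ ϕ), ξ⟩| ≤ ε c |φ|_k |ϕ|_k |ξ|_i`, with `k, i` depending only on the fields and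
on `T`, and `c` depending besides only on an upper bound for `ε`. -/
def MasslessLimit (F : Fin n₁ → FreeField r d) (G : Fin n₂ → FreeField r d)
    (T : I × J → 𝓢'(SpaceTime × SpaceTime, ℂ)) : Prop :=
  ∃ κ : ℝ → (ParticleSpace F G →L[ℂ] (TestSpace I J n₁ n₂ d →L[ℂ] ℂ)),
    (∀ ε, 0 ≤ ε → IsProductKernel ε F G T (κ ε)) ∧
    Filter.Tendsto κ (𝓝[>] 0) (𝓝 (κ 0)) ∧
    ∃ k i : ℕ, ∀ ε₀ : ℝ, 0 < ε₀ → ∃ c : ℝ, ∀ ε : ℝ, 0 < ε → ε ≤ ε₀ →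
      ∀ (φ : 𝓢(SpaceTime, Components I n₁ d → ℂ)) (ϕ : 𝓢(SpaceTime, Components J n₂ d → ℂ))
        (ξ : ParticleSpace F G),
        ‖κ ε ξ (componentTensor φ ϕ) - κ 0 ξ (componentTensor φ ϕ)‖ ≤
          ε * c * schwartzNorm k φ * schwartzNorm k ϕ *
            schwartzNorm i
              (ξ : 𝓢(Fin n₁ ⊕ Fin n₂ → Momentum, (Fin n₁ ⊕ Fin n₂ → Fin r) → ℂ))

end NonContracted

end PlaneWave

end

/-!
Both assertions are instances of one about an arbitrary tempered distribution `T`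
(`masslessLimit`).

The product of the plane waves at `(x, y)` is `∫ c(p) e^{i L_ε(p)(x, y)} dp`, where `c(p)` is the
product of the amplitudes and of the test function `ξ`, and the phase `L_ε(p)` is a linear form on
`ℝ⁴ × ℝ⁴` (`waveIntegrand_eq`). Only the phase depends on `ε`. Two facts carry the proof.

The coefficient `c` is rapidly decreasing, and its size is controlled by a Schwartz norm of `ξ`.
A multiplier of the single particle space, tested on bumps rescaled to the distance from zero
momentum, is polynomially bounded up to a singularity of finite order at zero in the massless case
(`IsMultiplier.growth`). There `ξ` vanishes to all orders (`norm_le_infraredScale_pow_mul`), and the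
resulting bounds for the different fields are combined with the decay at infinity by taking their
geometric mean (`norm_mul_one_add_pow_le_prod`, `exists_norm_prod_multiplier_mul_le`).

Since `|√(|𝐩|² + ε²) - |𝐩|| ≤ |ε|`, the phases satisfy `‖L_ε(p) - L_0(p)‖ ≤ (n₁ + n₂) |ε|`, and they
grow at most linearly in `p`. Hence the derivatives in `(x, y)` of `e^{i L_ε(p)(x, y)}` are bounded
by powers of `1 + |p|`, and change by `O(ε (1 + |(x, y)|))` times such a power between `0` and `ε`
(`norm_iteratedFDeriv_planeWave_sub_le`). After integration, the products of plane waves are smooth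
with bounded derivatives, and converge with rate `ε` together with their derivatives, up to one
factor `1 + |(x, y)|` (`exists_norm_iteratedFDeriv_waveProduct_sub_le`).

As `T` is bounded by a Schwartz norm, this gives `|κ_ε(ξ)(χ)| ≤ C |ξ|_k |χ|_l` and
`|(κ_ε - κ_0)(ξ)(χ)| ≤ ε C |ξ|_k |χ|_l` for all test functions `χ` of two variables. Schwartz norms
are bounded on bounded sets, so that the first estimate yields the continuity into the strong dual
(`continuous_of_norm_apply_le`), the second one the convergence (`tendsto_of_norm_sub_apply_le`)
and, at `χ = φ ⊗ ϕ`, the bound.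
-/

noncomputable section

namespace PlaneWave

/-! ### The norms of the Schwartz spaces -/

section SchwartzNorm

variable {D V : Type*} [NormedAddCommGroup D] [NormedSpace ℝ D] [NormedAddCommGroup V]
  [NormedSpace ℂ V] [NormedSpace ℝ V] [SMulCommClass ℝ ℂ V]

theorem le_schwartzNorm {j l k : ℕ} (hj : j ≤ k) (hl : l ≤ k) (f : 𝓢(D, V)) (x : D) :
    ‖x‖ ^ j * ‖iteratedFDeriv ℝ l f x‖ ≤ schwartzNorm k f := by
  refine (SchwartzMap.le_seminorm ℂ j l f x).trans ?_
  exact Seminorm.le_def.1 (Finset.le_sup (f := schwartzSeminormFamily ℂ D V)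
    (show (j, l) ∈ Finset.Iic (k, k) by simp [hj, hl])) f

theorem norm_iteratedFDeriv_le_schwartzNorm {l k : ℕ} (hl : l ≤ k) (f : 𝓢(D, V)) (x : D) :
    ‖iteratedFDeriv ℝ l f x‖ ≤ schwartzNorm k f := by
  simpa using le_schwartzNorm (Nat.zero_le k) hl f x

theorem norm_le_schwartzNorm (k : ℕ) (f : 𝓢(D, V)) (x : D) : ‖f x‖ ≤ schwartzNorm k f := by
  simpa using norm_iteratedFDeriv_le_schwartzNorm (Nat.zero_le k) f x

theorem schwartzNorm_le {k : ℕ} {f : 𝓢(D, V)} {M : ℝ} (hM : 0 ≤ M)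
    (h : ∀ j ≤ k, ∀ l ≤ k, ∀ x, ‖x‖ ^ j * ‖iteratedFDeriv ℝ l f x‖ ≤ M) :
    schwartzNorm k f ≤ M := by
  refine Seminorm.finset_sup_apply_le hM fun q hq => ?_
  rw [Finset.mem_Iic, Prod.le_def] at hq
  exact SchwartzMap.seminorm_le_bound ℂ q.1 q.2 f hM (h _ hq.1 _ hq.2)

theorem schwartzNorm_mono {k l : ℕ} (h : k ≤ l) (f : 𝓢(D, V)) :
    schwartzNorm k f ≤ schwartzNorm l f :=
  schwartzNorm_le (apply_nonneg _ _) fun _ hj _ hi x =>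
    le_schwartzNorm (hj.trans h) (hi.trans h) f x

/-- The norms `schwartzNorm k` dominate all continuous seminorms of a space which carries the
topology induced from a Schwartz space. -/
theorem exists_le_schwartzNorm {E : Type*} [AddCommGroup E] [Module ℂ E] [TopologicalSpace E]
    (f : E →ₗ[ℂ] 𝓢(D, V)) (hf : Topology.IsInducing f) (p : Seminorm ℂ E) (hp : Continuous p) :
    ∃ (k : ℕ) (C : ℝ), 0 ≤ C ∧ ∀ x, p x ≤ C * schwartzNorm k (f x) := by
  have h := LinearMap.withSeminorms_induced (schwartz_withSeminorms ℂ D V) f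
  have e : (inferInstance : TopologicalSpace E) = TopologicalSpace.induced f inferInstance :=
    hf.eq_induced
  obtain ⟨s, C, -, hC⟩ := Seminorm.bound_of_continuous
    (t := TopologicalSpace.induced f inferInstance) h p (by rw [← e]; exact hp)
  refine ⟨s.sup (fun q => max q.1 q.2), C, C.2, fun x => ?_⟩
  refine (Seminorm.le_def.1 hC x).trans ?_
  simp only [smul_apply, NNReal.smul_def, smul_eq_mul]
  refine mul_le_mul_of_nonneg_left ?_ C.2
  refine Seminorm.finset_sup_apply_le (apply_nonneg _ _) fun q hq => ?_
  have hq' : max q.1 q.2 ≤ s.sup (fun q => max q.1 q.2) :=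
    Finset.le_sup (f := fun q : ℕ × ℕ => max q.1 q.2) hq
  exact SchwartzMap.seminorm_le_bound ℂ q.1 q.2 _ (apply_nonneg _ _) fun y =>
    le_schwartzNorm ((le_max_left _ _).trans hq') ((le_max_right _ _).trans hq') _ y

end SchwartzNorm

/-! ### Multipliers of the single particle spaces -/

/-- The distance to the infrared singularity: `min 1 |𝐪|` for a massless field, `1` for a massive
one. -/
def infraredScale (m : ℝ) (q : Momentum) : ℝ := if m = 0 then min 1 ‖q‖ else 1

theorem infraredScale_nonneg (m : ℝ) (q : Momentum) : 0 ≤ infraredScale m q := by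
  unfold infraredScale; split_ifs <;> positivity

theorem infraredScale_le_one (m : ℝ) (q : Momentum) : infraredScale m q ≤ 1 := by
  unfold infraredScale; split_ifs <;> simp

theorem exists_bump : ∃ χ : 𝓢(Momentum, ℂ), χ 0 = 1 ∧ ∀ x, 1 / 2 ≤ ‖x‖ → χ x = 0 := by
  let b : ContDiffBump (0 : Momentum) := ⟨1 / 4, 1 / 2, by norm_num, by norm_num⟩
  have hb : ∀ x, 1 / 2 ≤ ‖x‖ → (b x : ℂ) = 0 := fun x hx => by
    rw [b.zero_of_le_dist (by rw [dist_zero_right]; exact hx), Complex.ofReal_zero]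
  have hc : HasCompactSupport (fun x => (b x : ℂ)) :=
    HasCompactSupport.intro (isCompact_closedBall (0 : Momentum) (1 / 2)) fun x hx =>
      hb x (le_of_lt (by simpa using hx))
  have hs : ContDiff ℝ (⊤ : ℕ∞) (fun x => (b x : ℂ)) := Complex.ofRealCLM.contDiff.comp b.contDiff
  have h1 : b 0 = 1 := b.one_of_mem_closedBall (Metric.mem_closedBall_self b.rIn_pos.le)
  exact ⟨hc.toSchwartzMap hs, by simp [h1], hb⟩

/-- The rescaled bumps `p ↦ χ((p - q) / ρ)` have Schwartz norms which grow at most like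
`((1 + |q|) / ρ)ᵏ`. -/
theorem exists_scaled_bump (k : ℕ) : ∃ C : ℝ, 0 ≤ C ∧ ∀ (q : Momentum) (ρ : ℝ), 0 < ρ → ρ ≤ 1 →
    ∃ f : 𝓢(Momentum, ℂ), f q = 1 ∧ (∀ p, ρ / 2 ≤ ‖p - q‖ → f p = 0) ∧
      schwartzNorm k f * ρ ^ k ≤ C * (1 + ‖q‖) ^ k := by
  obtain ⟨χ, h1, h0⟩ := exists_bump
  refine ⟨schwartzNorm k χ, apply_nonneg _ _, fun q ρ hρ hρ1 => ?_⟩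
  have hz : ∀ p, ρ / 2 ≤ ‖p - q‖ → χ (ρ⁻¹ • (p - q)) = 0 := fun p hp => by
    refine h0 _ ?_
    rw [norm_smul, norm_inv, Real.norm_of_nonneg hρ.le, inv_mul_eq_div, le_div_iff₀ hρ]
    linarith
  have hsub : tsupport (fun p => χ (ρ⁻¹ • (p - q))) ⊆ Metric.closedBall q 1 := by
    refine closure_minimal (fun p hp => ?_) Metric.isClosed_closedBall
    by_contra hcon
    rw [mem_closedBall_iff_norm, not_le] at hcon
    exact hp (hz p (by linarith))
  have hc : HasCompactSupport (fun p => χ (ρ⁻¹ • (p - q))) :=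
    (isCompact_closedBall q 1).of_isClosed_subset (isClosed_tsupport _) hsub
  have hg : ContDiff ℝ (⊤ : ℕ∞) (fun x => χ (ρ⁻¹ • x)) :=
    (χ.smooth ⊤).comp (contDiff_const_smul _)
  have hs : ContDiff ℝ (⊤ : ℕ∞) (fun p => χ (ρ⁻¹ • (p - q))) :=
    hg.comp (contDiff_id.sub contDiff_const)
  have hρk : 0 < ρ ^ k := by positivity
  refine ⟨hc.toSchwartzMap hs, by simp [h1], hz, ?_⟩
  rw [← le_div_iff₀ hρk]
  refine schwartzNorm_le (div_nonneg (mul_nonneg (apply_nonneg _ _) (by positivity)) hρk.le)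
    fun j hj l hl p => ?_
  rw [le_div_iff₀ hρk]
  change ‖p‖ ^ j * ‖iteratedFDeriv ℝ l (fun p => χ (ρ⁻¹ • (p - q))) p‖ * ρ ^ k ≤ _
  by_cases hp : p ∈ Metric.closedBall q 1
  · have e : iteratedFDeriv ℝ l (fun p => χ (ρ⁻¹ • (p - q))) p =
        ρ⁻¹ ^ l • iteratedFDeriv ℝ l χ (ρ⁻¹ • (p - q)) := by
      have h := iteratedFDeriv_comp_sub (𝕜 := ℝ) (f := fun x => χ (ρ⁻¹ • x)) l q p
      rw [h, iteratedFDeriv_comp_const_smul _ ((χ.smooth ⊤).of_le (by exact_mod_cast le_top))]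
    have hd := norm_iteratedFDeriv_le_schwartzNorm hl χ (ρ⁻¹ • (p - q))
    have hn : ‖p‖ ≤ 1 + ‖q‖ := by
      have := norm_add_le (p - q) q
      rw [sub_add_cancel] at this
      linarith [mem_closedBall_iff_norm.1 hp]
    have hpow : ρ⁻¹ ^ l * ρ ^ k ≤ 1 := by
      rw [inv_pow, inv_mul_le_one₀ (by positivity)]
      exact pow_le_pow_of_le_one hρ.le hρ1 hl
    have hnk : ‖p‖ ^ j ≤ (1 + ‖q‖) ^ k := by
      calc ‖p‖ ^ j ≤ (1 + ‖q‖) ^ j := by gcongr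
        _ ≤ _ := pow_le_pow_right₀ (by linarith [norm_nonneg q]) hj
    rw [e, norm_smul, Real.norm_of_nonneg (by positivity)]
    calc ‖p‖ ^ j * (ρ⁻¹ ^ l * ‖iteratedFDeriv ℝ l χ (ρ⁻¹ • (p - q))‖) * ρ ^ k
        = ‖p‖ ^ j * ‖iteratedFDeriv ℝ l χ (ρ⁻¹ • (p - q))‖ * (ρ⁻¹ ^ l * ρ ^ k) := by ring
      _ ≤ ‖p‖ ^ j * ‖iteratedFDeriv ℝ l χ (ρ⁻¹ • (p - q))‖ :=
        mul_le_of_le_one_right (by positivity) hpow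
      _ ≤ (1 + ‖q‖) ^ k * schwartzNorm k χ := by gcongr
      _ = _ := mul_comm _ _
  · have e : iteratedFDeriv ℝ l (fun p => χ (ρ⁻¹ • (p - q))) p = 0 := by
      by_contra hcon
      exact hp (hsub (support_iteratedFDeriv_subset l hcon))
    rw [e, norm_zero, mul_zero, zero_mul]
    exact mul_nonneg (apply_nonneg _ _) (by positivity)

/-- A test function which vanishes near zero, or an arbitrary one if the mass is not zero, lies in
the single particle space. -/
theorem mem_singleParticleSpace_of_support {m : ℝ} {q : Momentum} {f : 𝓢(Momentum, ℂ)}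
    (hq : 0 < infraredScale m q) (h : ∀ p, infraredScale m q / 2 ≤ ‖p - q‖ → f p = 0) :
    f ∈ singleParticleSpace m := by
  intro hm n
  have hq0 : 0 < ‖q‖ := by
    rw [infraredScale, if_pos hm, lt_min_iff] at hq
    exact hq.2
  have hle : infraredScale m q ≤ ‖q‖ := by
    rw [infraredScale, if_pos hm]
    exact min_le_right _ _
  have hev : ⇑f =ᶠ[𝓝 0] fun _ => (0 : ℂ) := by
    filter_upwards [Metric.ball_mem_nhds (0 : Momentum) (half_pos hq0)] with p hp
    rw [mem_ball_zero_iff] at hp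
    refine h p ?_
    have := norm_sub_norm_le q p
    rw [norm_sub_rev] at this
    linarith
  rw [(Filter.EventuallyEq.iteratedFDeriv ℝ hev n).eq_of_nhds, iteratedFDeriv_fun_zero]
  rfl

theorem exists_mem_singleParticleSpace (k : ℕ) : ∃ C : ℝ, 0 ≤ C ∧ ∀ (m : ℝ) (q : Momentum),
    0 < infraredScale m q → ∃ f : singleParticleSpace m, (f : 𝓢(Momentum, ℂ)) q = 1 ∧
      schwartzNorm k (f : 𝓢(Momentum, ℂ)) * infraredScale m q ^ k ≤ C * (1 + ‖q‖) ^ k := by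
  obtain ⟨C, hC, h⟩ := exists_scaled_bump k
  refine ⟨C, hC, fun m q hq => ?_⟩
  obtain ⟨f, h1, h0, hf⟩ := h q _ hq (infraredScale_le_one m q)
  exact ⟨⟨f, mem_singleParticleSpace_of_support hq h0⟩, h1, hf⟩

/-- A multiplier is polynomially bounded, up to a singularity of finite order at zero momentum if
the mass vanishes: this follows from the continuity of the multiplication operator, tested on bumps
rescaled to the distance from the singularity. -/
theorem IsMultiplier.growth {m : ℝ} {u : Momentum → ℂ}
    (hu : IsMultiplier (singleParticleSpace m) u) :
    ∃ (k : ℕ) (C : ℝ), 0 ≤ C ∧ ∀ q, ‖u q‖ * infraredScale m q ^ k ≤ C * (1 + ‖q‖) ^ k := by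
  obtain ⟨A, hA⟩ := hu
  obtain ⟨k, C, hC, hb⟩ := exists_le_schwartzNorm (singleParticleSpace m).subtype
    Topology.IsInducing.subtypeVal
    ((schwartzSeminormFamily ℂ Momentum ℂ (0, 0)).comp
      ((singleParticleSpace m).subtype ∘ₗ (A : singleParticleSpace m →ₗ[ℂ] singleParticleSpace m)))
    (((schwartz_withSeminorms ℂ Momentum ℂ).continuous_seminorm (0, 0)).comp
      (continuous_subtype_val.comp A.continuous))
  obtain ⟨C', hC', hf⟩ := exists_mem_singleParticleSpace k
  -- one more power than needed, so that the left side vanishes where the scale does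
  refine ⟨k + 1, C * C', by positivity, fun q => ?_⟩
  have h1q : 1 ≤ 1 + ‖q‖ := by linarith [norm_nonneg q]
  rcases (infraredScale_nonneg m q).eq_or_lt with h0 | h0
  · rw [← h0, zero_pow (by omega), mul_zero]
    positivity
  · obtain ⟨f, h1, h2⟩ := hf m q h0
    have e : ‖u q‖ ≤ C * schwartzNorm k (f : 𝓢(Momentum, ℂ)) := by
      calc ‖u q‖ = ‖(A f : 𝓢(Momentum, ℂ)) q‖ := by rw [hA, h1, mul_one]
        _ ≤ SchwartzMap.seminorm ℂ 0 0 (A f : 𝓢(Momentum, ℂ)) :=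
          SchwartzMap.norm_le_seminorm ℂ _ _
        _ ≤ _ := hb f
    calc ‖u q‖ * infraredScale m q ^ (k + 1) ≤ ‖u q‖ * infraredScale m q ^ k :=
          mul_le_mul_of_nonneg_left
            (pow_le_pow_of_le_one h0.le (infraredScale_le_one m q) (Nat.le_succ k)) (norm_nonneg _)
      _ ≤ C * schwartzNorm k (f : 𝓢(Momentum, ℂ)) * infraredScale m q ^ k := by gcongr
      _ = C * (schwartzNorm k (f : 𝓢(Momentum, ℂ)) * infraredScale m q ^ k) := by ring
      _ ≤ C * (C' * (1 + ‖q‖) ^ k) := by gcongr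
      _ = C * C' * (1 + ‖q‖) ^ k := by ring
      _ ≤ C * C' * (1 + ‖q‖) ^ (k + 1) := by
        gcongr
        omega

theorem IsMultiplier.measurable {m : ℝ} {u : Momentum → ℂ}
    (hu : IsMultiplier (singleParticleSpace m) u) : Measurable u := by
  obtain ⟨A, hA⟩ := hu
  obtain ⟨_, -, hf⟩ := exists_mem_singleParticleSpace 0
  refine measurable_of_continuousOn_compl_singleton 0 fun q hq => ?_
  have hq0 : 0 < infraredScale m q := by
    have := norm_pos_iff.2 hq
    unfold infraredScale
    split_ifs <;> positivity
  -- near `q` the multiplier is the quotient of two test functions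
  obtain ⟨f, h1, -⟩ := hf m q hq0
  have hc : ContinuousAt (fun p => (A f : 𝓢(Momentum, ℂ)) p / (f : 𝓢(Momentum, ℂ)) p) q :=
    (A f : 𝓢(Momentum, ℂ)).continuous.continuousAt.div
      (f : 𝓢(Momentum, ℂ)).continuous.continuousAt (by rw [h1]; exact one_ne_zero)
  refine (hc.congr ?_).continuousWithinAt
  filter_upwards [(f : 𝓢(Momentum, ℂ)).continuous.continuousAt.eventually_ne
    (show (f : 𝓢(Momentum, ℂ)) q ≠ 0 by rw [h1]; exact one_ne_zero)] with p hp
  rw [hA, mul_div_cancel_right₀ _ hp]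

/-! ### Decay of test functions at the infrared singularities -/

section TensorSpace

variable {ι : Type} [Fintype ι] [DecidableEq ι] {r : ℕ} {m : ι → ℝ}

/-- Where a massless momentum is small, the test functions are small of every order: the mean value
inequality is applied repeatedly between `p` and the point where `p i` is replaced by zero. -/
theorem norm_iteratedFDeriv_le_pow_mul (ξ : tensorSpace r m) {i : ι} (hi : m i = 0) (M : ℕ) :
    ∀ (j : ℕ) (p : ι → Momentum),
      ‖iteratedFDeriv ℝ j (ξ : 𝓢(ι → Momentum, (ι → Fin r) → ℂ)) p‖ ≤
        ‖p i‖ ^ M * schwartzNorm (j + M) (ξ : 𝓢(ι → Momentum, (ι → Fin r) → ℂ)) := by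
  obtain ⟨ξ, hξ⟩ := ξ
  induction M with
  | zero =>
    intro j p
    simpa using norm_iteratedFDeriv_le_schwartzNorm le_rfl ξ p
  | succ M ih =>
    intro j p
    have h0 : iteratedFDeriv ℝ j ξ (Function.update p i 0) = 0 := hξ i hi j _ (by simp)
    have hconv : Convex ℝ {y : ι → Momentum | ‖y i‖ ≤ ‖p i‖} := by
      have h := (convex_closedBall (0 : Momentum) ‖p i‖).linear_preimage
        (LinearMap.proj (R := ℝ) (φ := fun _ : ι => Momentum) i)
      simpa only [Set.preimage, LinearMap.proj_apply, mem_closedBall_zero_iff] using h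
    have hd : Differentiable ℝ (iteratedFDeriv ℝ j ξ) :=
      (ξ.smooth ⊤).differentiable_iteratedFDeriv (by exact_mod_cast ENat.natCast_lt_top j)
    have h := hconv.norm_image_sub_le_of_norm_fderiv_le (𝕜 := ℝ) (f := iteratedFDeriv ℝ j ξ)
      (C := ‖p i‖ ^ M * schwartzNorm (j + 1 + M) ξ) (fun y _ => hd y)
      (fun y hy => by
        rw [norm_fderiv_iteratedFDeriv]
        refine (ih (j + 1) y).trans ?_
        gcongr
        exact hy)
      (show Function.update p i 0 ∈ {y : ι → Momentum | ‖y i‖ ≤ ‖p i‖} by simp)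
      (show p ∈ {y : ι → Momentum | ‖y i‖ ≤ ‖p i‖} by simp)
    have hn : ‖p - Function.update p i 0‖ ≤ ‖p i‖ := by
      refine (pi_norm_le_iff_of_nonneg (norm_nonneg _)).2 fun l => ?_
      by_cases hl : l = i
      · subst hl; simp
      · simp [Function.update_of_ne hl]
    change ‖iteratedFDeriv ℝ j ξ p‖ ≤ ‖p i‖ ^ (M + 1) * schwartzNorm (j + (M + 1)) ξ
    rw [h0, sub_zero] at h
    refine h.trans ((mul_le_mul_of_nonneg_left hn (by positivity)).trans_eq ?_)
    rw [show j + 1 + M = j + (M + 1) by ring]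
    ring

theorem norm_le_infraredScale_pow_mul (ξ : tensorSpace r m) (i : ι) (M : ℕ) (p : ι → Momentum) :
    ‖(ξ : 𝓢(ι → Momentum, (ι → Fin r) → ℂ)) p‖ ≤ infraredScale (m i) (p i) ^ M *
      schwartzNorm M (ξ : 𝓢(ι → Momentum, (ι → Fin r) → ℂ)) := by
  unfold infraredScale
  split_ifs with hi
  · rcases le_total 1 ‖p i‖ with h | h
    · simpa [min_eq_left h] using norm_le_schwartzNorm M (ξ : 𝓢(ι → Momentum, (ι → Fin r) → ℂ)) p
    · rw [min_eq_right h]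
      simpa using norm_iteratedFDeriv_le_pow_mul ξ hi M 0 p
  · simpa using norm_le_schwartzNorm M (ξ : 𝓢(ι → Momentum, (ι → Fin r) → ℂ)) p

theorem norm_mul_one_add_pow_le (ξ : 𝓢(ι → Momentum, (ι → Fin r) → ℂ)) (N : ℕ)
    (p : ι → Momentum) : ‖ξ p‖ * (1 + ‖p‖) ^ N ≤ 2 ^ N * schwartzNorm N ξ := by
  have h := SchwartzMap.one_add_le_sup_seminorm_apply (𝕜 := ℂ) (m := (N, N)) (k := N) (n := 0)
    le_rfl (Nat.zero_le N) ξ p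
  rw [norm_iteratedFDeriv_zero, mul_comm] at h
  exact h

/-- Simultaneous decay at infinity and at all the infrared singularities. The test function is
bounded by each of the `n` infrared factors and by the factor at infinity alone, hence by the
geometric mean of these `n + 1` bounds. -/
theorem norm_mul_one_add_pow_le_prod (k N : ℕ) : ∃ (K : ℕ) (C : ℝ), 0 ≤ C ∧
    ∀ (ξ : tensorSpace r m) (p : ι → Momentum),
      ‖(ξ : 𝓢(ι → Momentum, (ι → Fin r) → ℂ)) p‖ * (1 + ‖p‖) ^ N ≤
        C * (∏ i, infraredScale (m i) (p i) ^ k) *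
          schwartzNorm K (ξ : 𝓢(ι → Momentum, (ι → Fin r) → ℂ)) := by
  set n := Fintype.card ι + 1 with hn
  refine ⟨(k + N) * n, 2 ^ N, by positivity, fun ξ p => ?_⟩
  set S := schwartzNorm ((k + N) * n) (ξ : 𝓢(ι → Momentum, (ι → Fin r) → ℂ)) with hS
  set t := ‖(ξ : 𝓢(ι → Momentum, (ι → Fin r) → ℂ)) p‖ with ht
  have hS0 : 0 ≤ S := apply_nonneg _ _
  have hsc : ∀ i, 0 ≤ infraredScale (m i) (p i) := fun i => infraredScale_nonneg _ _
  have h1 : ∀ i, t ≤ infraredScale (m i) (p i) ^ (k * n) * S := fun i =>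
    (norm_le_infraredScale_pow_mul ξ i (k * n) p).trans <|
      mul_le_mul_of_nonneg_left (schwartzNorm_mono (by gcongr; omega) _) (pow_nonneg (hsc i) _)
  have h2 : t * (1 + ‖p‖) ^ (N * n) ≤ 2 ^ (N * n) * S :=
    (norm_mul_one_add_pow_le _ (N * n) p).trans <|
      mul_le_mul_of_nonneg_left (schwartzNorm_mono (by gcongr; omega) _) (by positivity)
  have hP : 0 ≤ ∏ i, infraredScale (m i) (p i) ^ k :=
    Finset.prod_nonneg fun i _ => pow_nonneg (hsc i) _
  refine le_of_pow_le_pow_left₀ (n := n) (by omega) (by positivity) ?_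
  calc (t * (1 + ‖p‖) ^ N) ^ n = (∏ _i : ι, t) * (t * (1 + ‖p‖) ^ (N * n)) := by
        rw [Finset.prod_const, Finset.card_univ, mul_pow, ← pow_mul, hn, pow_succ]
        ring
    _ ≤ (∏ i, infraredScale (m i) (p i) ^ (k * n) * S) * (2 ^ (N * n) * S) := by
        refine mul_le_mul (Finset.prod_le_prod (fun _ _ => norm_nonneg _) fun i _ => h1 i) h2
          (by positivity) (Finset.prod_nonneg fun i _ => mul_nonneg (pow_nonneg (hsc i) _) hS0)
    _ = _ := by
        rw [Finset.prod_mul_distrib, Finset.prod_const, Finset.card_univ, mul_pow, mul_pow,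
          ← Finset.prod_pow, ← pow_mul, hn, pow_succ S]
        simp_rw [← pow_mul]
        ring

/-- A product of multipliers of the single particle spaces maps the test functions to rapidly
decreasing functions. -/
theorem exists_norm_prod_multiplier_mul_le {w : ι → Momentum → ℂ}
    (hw : ∀ i, IsMultiplier (singleParticleSpace (m i)) (w i)) (N : ℕ) :
    ∃ (K : ℕ) (C : ℝ), 0 ≤ C ∧ ∀ (ξ : tensorSpace r m) (p : ι → Momentum),
      ‖∏ i, w i (p i)‖ * ‖(ξ : 𝓢(ι → Momentum, (ι → Fin r) → ℂ)) p‖ * (1 + ‖p‖) ^ N ≤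
        C * schwartzNorm K (ξ : 𝓢(ι → Momentum, (ι → Fin r) → ℂ)) := by
  choose k B hB hg using fun i => (hw i).growth
  obtain ⟨K, C, hC, h⟩ := norm_mul_one_add_pow_le_prod (r := r) (m := m)
    (Finset.univ.sup k) (N + ∑ i, k i)
  have hB' : 0 ≤ ∏ i, B i := Finset.prod_nonneg fun i _ => hB i
  refine ⟨K, (∏ i, B i) * C, mul_nonneg hB' hC, fun ξ p => ?_⟩
  set S := schwartzNorm K (ξ : 𝓢(ι → Momentum, (ι → Fin r) → ℂ)) with hS
  have hS0 : 0 ≤ S := apply_nonneg _ _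
  have hw' : ‖∏ i, w i (p i)‖ * ∏ i, infraredScale (m i) (p i) ^ (Finset.univ.sup k) ≤
      (∏ i, B i) * (1 + ‖p‖) ^ ∑ i, k i := by
    rw [norm_prod, ← Finset.prod_mul_distrib, ← Finset.prod_pow_eq_pow_sum,
      ← Finset.prod_mul_distrib]
    refine Finset.prod_le_prod (fun i _ => mul_nonneg (norm_nonneg _)
      (pow_nonneg (infraredScale_nonneg _ _) _)) fun i _ => ?_
    calc ‖w i (p i)‖ * infraredScale (m i) (p i) ^ (Finset.univ.sup k)
        ≤ ‖w i (p i)‖ * infraredScale (m i) (p i) ^ k i :=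
          mul_le_mul_of_nonneg_left (pow_le_pow_of_le_one (infraredScale_nonneg _ _)
            (infraredScale_le_one _ _) (Finset.le_sup (Finset.mem_univ i))) (norm_nonneg _)
      _ ≤ B i * (1 + ‖p i‖) ^ k i := hg i (p i)
      _ ≤ B i * (1 + ‖p‖) ^ k i :=
          mul_le_mul_of_nonneg_left (by gcongr; exact norm_le_pi_norm p i) (hB i)
  have hpos : 0 < (1 + ‖p‖) ^ ∑ i, k i := by positivity
  refine le_of_mul_le_mul_right ?_ hpos
  calc ‖∏ i, w i (p i)‖ * ‖(ξ : 𝓢(ι → Momentum, (ι → Fin r) → ℂ)) p‖ * (1 + ‖p‖) ^ N *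
        (1 + ‖p‖) ^ ∑ i, k i
      = ‖∏ i, w i (p i)‖ * (‖(ξ : 𝓢(ι → Momentum, (ι → Fin r) → ℂ)) p‖ *
          (1 + ‖p‖) ^ (N + ∑ i, k i)) := by ring
    _ ≤ ‖∏ i, w i (p i)‖ *
          (C * (∏ i, infraredScale (m i) (p i) ^ (Finset.univ.sup k)) * S) :=
        mul_le_mul_of_nonneg_left (h ξ p) (norm_nonneg _)
    _ = (‖∏ i, w i (p i)‖ * ∏ i, infraredScale (m i) (p i) ^ (Finset.univ.sup k)) * (C * S) := by
        ring
    _ ≤ ((∏ i, B i) * (1 + ‖p‖) ^ ∑ i, k i) * (C * S) :=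
        mul_le_mul_of_nonneg_right hw' (mul_nonneg hC hS0)
    _ = _ := by ring

end TensorSpace

/-! ### Smooth parametric integrals -/

section ParametricIntegral

open MeasureTheory

variable {α V E : Type*} [MeasurableSpace α] {μ : Measure α} [NormedAddCommGroup V]
  [NormedSpace ℝ V] [NormedAddCommGroup E] [NormedSpace ℝ E] {H : α → V → E} {b : ℕ → α → ℝ}

theorem hasFDerivAt_integral_iteratedFDeriv (hH : ∀ p, ContDiff ℝ (⊤ : ℕ∞) (H p))
    (hm : ∀ n z, AEStronglyMeasurable (fun p => iteratedFDeriv ℝ n (H p) z) μ)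
    (hb : ∀ n p z, ‖iteratedFDeriv ℝ n (H p) z‖ ≤ b n p) (hi : ∀ n, Integrable (b n) μ)
    (n : ℕ) (z : V) :
    HasFDerivAt (fun z => ∫ p, iteratedFDeriv ℝ n (H p) z ∂μ)
      (∫ p, fderiv ℝ (iteratedFDeriv ℝ n (H p)) z ∂μ) z := by
  have hd : ∀ p, Differentiable ℝ (iteratedFDeriv ℝ n (H p)) := fun p =>
    (hH p).differentiable_iteratedFDeriv (by exact_mod_cast ENat.natCast_lt_top n)
  refine hasFDerivAt_integral_of_dominated_of_fderiv_le (s := Set.univ) (bound := b (n + 1))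
    Filter.univ_mem (.of_forall fun y => hm n y)
    ((hi n).mono' (hm n z) (.of_forall fun p => hb n p z)) ?_
    (.of_forall fun p y _ => ?_) (hi (n + 1)) (.of_forall fun p y _ => (hd p y).hasFDerivAt)
  · have h := (continuousMultilinearCurryLeftEquiv ℝ
      (fun _ : Fin (n + 1) => V) E).continuous.comp_aestronglyMeasurable (hm (n + 1) z)
    simpa only [iteratedFDeriv_succ_eq_comp_left, Function.comp_def,
      LinearIsometryEquiv.apply_symm_apply] using h
  · rw [norm_fderiv_iteratedFDeriv]
    exact hb (n + 1) p y

/-- Differentiation of any order under the integral sign. -/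
theorem iteratedFDeriv_integral [CompleteSpace E] (hH : ∀ p, ContDiff ℝ (⊤ : ℕ∞) (H p))
    (hm : ∀ n z, AEStronglyMeasurable (fun p => iteratedFDeriv ℝ n (H p) z) μ)
    (hb : ∀ n p z, ‖iteratedFDeriv ℝ n (H p) z‖ ≤ b n p) (hi : ∀ n, Integrable (b n) μ)
    (n : ℕ) :
    iteratedFDeriv ℝ n (fun z => ∫ p, H p z ∂μ) =
      fun z => ∫ p, iteratedFDeriv ℝ n (H p) z ∂μ := by
  induction n with
  | zero =>
    ext1 z
    have e : ∀ f : V → E, iteratedFDeriv ℝ 0 f z =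
        (continuousMultilinearCurryFin0 ℝ V E).symm (f z) := fun f => by
      rw [iteratedFDeriv_zero_eq_comp]; rfl
    simp only [e]
    exact ((continuousMultilinearCurryFin0 ℝ V E).symm.toContinuousLinearEquiv.integral_comp_comm
      (fun p => H p z)).symm
  | succ n ih =>
    ext1 z
    have e : ∀ f : V → E, iteratedFDeriv ℝ (n + 1) f z =
        (continuousMultilinearCurryLeftEquiv ℝ (fun _ : Fin (n + 1) => V) E).symm
          (fderiv ℝ (iteratedFDeriv ℝ n f) z) := fun f => by
      rw [iteratedFDeriv_succ_eq_comp_left]; rfl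
    simp only [e]
    rw [ih, (hasFDerivAt_integral_iteratedFDeriv hH hm hb hi n z).fderiv]
    exact (ContinuousLinearEquiv.integral_comp_comm (μ := μ) (𝕜 := ℝ)
      (E := V →L[ℝ] (V [×n]→L[ℝ] E)) (F := V [×(n + 1)]→L[ℝ] E)
      (continuousMultilinearCurryLeftEquiv ℝ
        (fun _ : Fin (n + 1) => V) E).symm.toContinuousLinearEquiv _).symm

theorem contDiff_integral [CompleteSpace E] (hH : ∀ p, ContDiff ℝ (⊤ : ℕ∞) (H p))
    (hm : ∀ n z, AEStronglyMeasurable (fun p => iteratedFDeriv ℝ n (H p) z) μ)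
    (hb : ∀ n p z, ‖iteratedFDeriv ℝ n (H p) z‖ ≤ b n p) (hi : ∀ n, Integrable (b n) μ) :
    ContDiff ℝ (⊤ : ℕ∞) (fun z => ∫ p, H p z ∂μ) := by
  refine contDiff_of_differentiable_iteratedFDeriv fun n _ => ?_
  rw [iteratedFDeriv_integral hH hm hb hi n]
  exact fun z => (hasFDerivAt_integral_iteratedFDeriv hH hm hb hi n z).differentiableAt

end ParametricIntegral

/-! ### Oscillating exponentials -/

section Oscillation

variable {V : Type*} [NormedAddCommGroup V] [NormedSpace ℝ V]

/-- The plane wave `z ↦ exp (i ℓ(z))` with the phase `ℓ`. -/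
def planeWave (ℓ : V →L[ℝ] ℝ) (z : V) : ℂ := Complex.exp (Complex.I * (ℓ z : ℂ))

theorem contDiff_exp_I_mul (n : WithTop ℕ∞) :
    ContDiff ℝ n (fun t : ℝ => Complex.exp (Complex.I * (t : ℂ))) :=
  (contDiff_const.mul Complex.ofRealCLM.contDiff).cexp

theorem contDiff_planeWave (ℓ : V →L[ℝ] ℝ) (n : WithTop ℕ∞) : ContDiff ℝ n (planeWave ℓ) :=
  (contDiff_exp_I_mul n).comp ℓ.contDiff

theorem iteratedFDeriv_planeWave (ℓ : V →L[ℝ] ℝ) (n : ℕ) (z : V) :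
    iteratedFDeriv ℝ n (planeWave ℓ) z =
      (iteratedFDeriv ℝ n (fun t : ℝ => Complex.exp (Complex.I * (t : ℂ)))
        (ℓ z)).compContinuousLinearMap fun _ => ℓ :=
  ℓ.iteratedFDeriv_comp_right (contDiff_exp_I_mul n) z le_rfl

theorem iteratedDeriv_exp_I_mul (n : ℕ) :
    iteratedDeriv n (fun t : ℝ => Complex.exp (Complex.I * (t : ℂ))) =
      fun t : ℝ => Complex.I ^ n * Complex.exp (Complex.I * (t : ℂ)) := by
  induction n with
  | zero => simp
  | succ n ih =>
    rw [iteratedDeriv_succ, ih]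
    ext1 t
    have h : HasDerivAt (fun t : ℝ => Complex.exp (Complex.I * (t : ℂ)))
        (Complex.exp (Complex.I * (t : ℂ)) * (Complex.I * 1)) t :=
      ((Complex.ofRealCLM.hasDerivAt (x := t)).const_mul Complex.I).cexp
    rw [(h.const_mul _).deriv]
    ring

theorem norm_iteratedFDeriv_planeWave_le (ℓ : V →L[ℝ] ℝ) (n : ℕ) (z : V) :
    ‖iteratedFDeriv ℝ n (planeWave ℓ) z‖ ≤ ‖ℓ‖ ^ n := by
  rw [iteratedFDeriv_planeWave]
  refine (ContinuousMultilinearMap.norm_compContinuousLinearMap_le _ _).trans ?_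
  rw [norm_iteratedFDeriv_eq_norm_iteratedDeriv, iteratedDeriv_exp_I_mul, norm_mul, norm_pow,
    Complex.norm_I, one_pow, one_mul, mul_comm Complex.I, Complex.norm_exp_ofReal_mul_I, one_mul,
    Finset.prod_const, Finset.card_univ, Fintype.card_fin]

/-- Continuity in the phase, from which the measurability in the momenta follows. -/
theorem continuous_iteratedFDeriv_planeWave (n : ℕ) (z : V) :
    Continuous fun ℓ : V →L[ℝ] ℝ => iteratedFDeriv ℝ n (planeWave ℓ) z := by
  simp_rw [iteratedFDeriv_planeWave]
  have h1 : Continuous fun ℓ : V →L[ℝ] ℝ =>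
      ContinuousMultilinearMap.compContinuousLinearMapContinuousMultilinear ℝ
        (fun _ : Fin n => V) (fun _ => ℝ) ℂ fun _ => ℓ :=
    (ContinuousMultilinearMap.cont _).comp (continuous_pi fun _ => continuous_id)
  have h2 : Continuous fun ℓ : V →L[ℝ] ℝ =>
      iteratedFDeriv ℝ n (fun t : ℝ => Complex.exp (Complex.I * (t : ℂ))) (ℓ z) :=
    ((contDiff_exp_I_mul n).continuous_iteratedFDeriv le_rfl).comp
      (ContinuousLinearMap.apply ℝ ℝ z).continuous
  exact h1.clm_apply h2

theorem planeWave_add (ℓ ℓ' : V →L[ℝ] ℝ) : planeWave (ℓ + ℓ') = planeWave ℓ * planeWave ℓ' := by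
  ext z
  simp only [planeWave, Pi.mul_apply, ← Complex.exp_add, add_apply,
    Complex.ofReal_add, mul_add]

theorem norm_iteratedFDeriv_planeWave_sub_one_le (δ : V →L[ℝ] ℝ) (n : ℕ) (z : V) :
    ‖iteratedFDeriv ℝ n (planeWave δ - fun _ => (1 : ℂ) : V → ℂ) z‖ ≤
      ‖δ‖ * (1 + ‖z‖) * (1 + ‖δ‖) ^ n := by
  rcases n with _ | n
  · rw [norm_iteratedFDeriv_zero, pow_zero, mul_one]
    calc ‖(planeWave δ - fun _ => (1 : ℂ) : V → ℂ) z‖ ≤ ‖δ z‖ :=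
          Real.norm_exp_I_mul_ofReal_sub_one_le
      _ ≤ ‖δ‖ * ‖z‖ := δ.le_opNorm z
      _ ≤ ‖δ‖ * (1 + ‖z‖) := by gcongr; linarith
  · rw [iteratedFDeriv_sub_apply (contDiff_planeWave δ _).contDiffAt contDiff_const.contDiffAt,
      iteratedFDeriv_succ_const, Pi.zero_apply, sub_zero]
    calc _ ≤ ‖δ‖ ^ (n + 1) := norm_iteratedFDeriv_planeWave_le δ _ z
      _ = ‖δ‖ * 1 * ‖δ‖ ^ n := by ring
      _ ≤ ‖δ‖ * (1 + ‖z‖) * (1 + ‖δ‖) ^ (n + 1) := by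
        gcongr
        · linarith [norm_nonneg z]
        · calc ‖δ‖ ^ n ≤ (1 + ‖δ‖) ^ n := by gcongr; linarith
            _ ≤ _ := pow_le_pow_right₀ (by linarith [norm_nonneg δ]) (Nat.le_succ n)

/-- The derivatives of a plane wave depend on the phase in a Lipschitz way, with a constant growing
linearly in `z`. -/
theorem norm_iteratedFDeriv_planeWave_sub_le (ℓ ℓ' : V →L[ℝ] ℝ) (n : ℕ) (z : V) :
    ‖iteratedFDeriv ℝ n (planeWave ℓ' - planeWave ℓ) z‖ ≤
      ‖ℓ' - ℓ‖ * (1 + ‖z‖) * (1 + ‖ℓ‖ + ‖ℓ' - ℓ‖) ^ n := by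
  set δ := ℓ' - ℓ with hδ
  -- the Leibniz rule is applied to `exp (iℓ') - exp (iℓ) = exp (iℓ) (exp (iδ) - 1)`
  have e : planeWave ℓ' - planeWave ℓ =
      fun z => planeWave ℓ z * (planeWave δ - fun _ => (1 : ℂ) : V → ℂ) z := by
    rw [show ℓ' = ℓ + δ by rw [hδ]; abel, planeWave_add]
    ext z
    simp only [Pi.sub_apply, Pi.mul_apply, mul_sub, mul_one]
  rw [e]
  refine (norm_iteratedFDeriv_mul_le (contDiff_planeWave ℓ (n : WithTop ℕ∞))
    ((contDiff_planeWave δ _).sub contDiff_const) z le_rfl).trans ?_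
  rw [show 1 + ‖ℓ‖ + ‖δ‖ = ‖ℓ‖ + (1 + ‖δ‖) by ring, add_pow, Finset.mul_sum]
  refine Finset.sum_le_sum fun i _ => ?_
  have h1 := norm_iteratedFDeriv_planeWave_le ℓ i z
  have h2 := norm_iteratedFDeriv_planeWave_sub_one_le δ (n - i) z
  calc _ ≤ (n.choose i : ℝ) * ‖ℓ‖ ^ i * (‖δ‖ * (1 + ‖z‖) * (1 + ‖δ‖) ^ (n - i)) := by
        gcongr
        exact h2
    _ = _ := by ring

end Oscillation

/-! ### Phases and amplitudes of the products of plane waves -/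

variable {r d : ℕ}

/-- The Minkowski product with the four-momentum `(e, 𝐩)` as a linear form on space-time. -/
def minkowskiCLM (e : ℝ) (p : Momentum) : SpaceTime →L[ℝ] ℝ :=
  e • EuclideanSpace.proj (0 : Fin 4) - ∑ j : Fin 3, p j • EuclideanSpace.proj j.succ

@[simp]
theorem minkowskiCLM_apply (e : ℝ) (p : Momentum) (x : SpaceTime) :
    minkowskiCLM e p x = minkowski e p x := by
  simp [minkowskiCLM, minkowski]

theorem norm_minkowskiCLM_le (e : ℝ) (p : Momentum) : ‖minkowskiCLM e p‖ ≤ |e| + 3 * ‖p‖ := by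
  refine ContinuousLinearMap.opNorm_le_bound _ (by positivity) fun x => ?_
  rw [minkowskiCLM_apply, minkowski]
  have h : ∀ j : Fin 3, ‖p j * x j.succ‖ ≤ ‖p‖ * ‖x‖ := fun j => by
    rw [norm_mul]
    exact mul_le_mul (PiLp.norm_apply_le p j) (PiLp.norm_apply_le x _) (norm_nonneg _)
      (norm_nonneg _)
  calc ‖e * x 0 - ∑ j : Fin 3, p j * x j.succ‖
      ≤ ‖e * x 0‖ + ‖∑ j : Fin 3, p j * x j.succ‖ := norm_sub_le _ _
    _ ≤ |e| * ‖x‖ + ∑ _j : Fin 3, ‖p‖ * ‖x‖ := by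
        refine add_le_add ?_ (norm_sum_le_of_le _ fun j _ => h j)
        rw [norm_mul, Real.norm_eq_abs]
        gcongr
        exact PiLp.norm_apply_le x 0
    _ = _ := by
        rw [Finset.sum_const, Finset.card_univ, Fintype.card_fin, nsmul_eq_mul]
        push_cast
        ring

theorem minkowskiCLM_sub (e e' : ℝ) (p : Momentum) :
    minkowskiCLM e p - minkowskiCLM e' p = minkowskiCLM (e - e') 0 := by
  ext x
  simp [minkowski]
  ring

theorem FreeField.continuous_energy (A : FreeField r d) (ε : ℝ) : Continuous (A.energy ε) := by
  unfold FreeField.energy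
  split_ifs <;> fun_prop

theorem FreeField.abs_energy_zero_le (A : FreeField r d) (p : Momentum) :
    |A.energy 0 p| ≤ ‖p‖ + A.mass := by
  have hm := A.mass_nonneg
  have hE : 0 ≤ A.energy 0 p := by unfold FreeField.energy; split_ifs <;> positivity
  rw [abs_of_nonneg hE]
  unfold FreeField.energy
  split_ifs with h
  · rw [h]; simp
  · exact Real.sqrt_le_iff.2 ⟨by positivity, by nlinarith [norm_nonneg p]⟩

theorem FreeField.abs_energy_sub_le (A : FreeField r d) (ε : ℝ) (p : Momentum) :
    |A.energy ε p - A.energy 0 p| ≤ |ε| := by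
  unfold FreeField.energy
  split_ifs with h
  · have h1 : √(‖p‖ ^ 2 + ε ^ 2) ≤ ‖p‖ + |ε| :=
      Real.sqrt_le_iff.2 ⟨by positivity, by
        rw [← sq_abs ε]; nlinarith [norm_nonneg p, abs_nonneg ε]⟩
    have h2 : ‖p‖ ≤ √(‖p‖ ^ 2 + ε ^ 2) := Real.le_sqrt_of_sq_le (by nlinarith [sq_nonneg ε])
    have h3 : √(‖p‖ ^ 2 + (0 : ℝ) ^ 2) = ‖p‖ := by simp
    rw [h3, abs_of_nonneg (by linarith)]
    linarith
  · simp

section NonContracted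

variable {n₁ n₂ : ℕ} (F : Fin n₁ → FreeField r d) (G : Fin n₂ → FreeField r d)

/-- The phase `∑_j q_j · y - ∑_i p_i · x` of the product of the plane waves of momenta `p_i` at `x`
and `q_j` at `y`, as a linear form in `(x, y)`. -/
def phase (ε : ℝ) (p : Fin n₁ ⊕ Fin n₂ → Momentum) : (SpaceTime × SpaceTime) →L[ℝ] ℝ :=
  (∑ j, minkowskiCLM ((G j).energy ε (p (.inr j))) (p (.inr j))).comp
      (ContinuousLinearMap.snd ℝ SpaceTime SpaceTime) -
    (∑ i, minkowskiCLM ((F i).energy ε (p (.inl i))) (p (.inl i))).comp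
      (ContinuousLinearMap.fst ℝ SpaceTime SpaceTime)

theorem phase_apply (ε : ℝ) (p : Fin n₁ ⊕ Fin n₂ → Momentum) (z : SpaceTime × SpaceTime) :
    phase F G ε p z = ∑ j, minkowski ((G j).energy ε (p (.inr j))) (p (.inr j)) z.2 -
      ∑ i, minkowski ((F i).energy ε (p (.inl i))) (p (.inl i)) z.1 := by
  simp [phase]

theorem norm_comp_snd_sub_comp_fst_le (A B : SpaceTime →L[ℝ] ℝ) :
    ‖A.comp (ContinuousLinearMap.snd ℝ SpaceTime SpaceTime) -
      B.comp (ContinuousLinearMap.fst ℝ SpaceTime SpaceTime)‖ ≤ ‖A‖ + ‖B‖ := by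
  refine (norm_sub_le _ _).trans (add_le_add ?_ ?_)
  · exact (ContinuousLinearMap.opNorm_comp_le _ _).trans
      (mul_le_of_le_one_right (norm_nonneg _) (ContinuousLinearMap.norm_snd_le _ _ _))
  · exact (ContinuousLinearMap.opNorm_comp_le _ _).trans
      (mul_le_of_le_one_right (norm_nonneg _) (ContinuousLinearMap.norm_fst_le _ _ _))

theorem exists_norm_phase_zero_le : ∃ c : ℝ, 0 ≤ c ∧ ∀ p, ‖phase F G 0 p‖ ≤ c * (1 + ‖p‖) := by
  have h : ∀ (A : FreeField r d) (i : Fin n₁ ⊕ Fin n₂) (p : Fin n₁ ⊕ Fin n₂ → Momentum),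
      ‖minkowskiCLM (A.energy 0 (p i)) (p i)‖ ≤ (4 + A.mass) * (1 + ‖p‖) := fun A i p => by
    refine (norm_minkowskiCLM_le _ _).trans ?_
    have h1 := A.abs_energy_zero_le (p i)
    have h2 := norm_le_pi_norm p i
    nlinarith [A.mass_nonneg, norm_nonneg p, mul_nonneg A.mass_nonneg (norm_nonneg p)]
  have hm : ∀ A : FreeField r d, 0 ≤ 4 + A.mass := fun A => by linarith [A.mass_nonneg]
  refine ⟨∑ j, (4 + (G j).mass) + ∑ i, (4 + (F i).mass), add_nonneg
    (Finset.sum_nonneg fun j _ => hm _) (Finset.sum_nonneg fun i _ => hm _), fun p => ?_⟩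
  refine (norm_comp_snd_sub_comp_fst_le _ _).trans ?_
  rw [add_mul, Finset.sum_mul, Finset.sum_mul]
  exact add_le_add (norm_sum_le_of_le _ fun j _ => h _ _ _)
    (norm_sum_le_of_le _ fun i _ => h _ _ _)

theorem norm_phase_sub_le (ε : ℝ) (p : Fin n₁ ⊕ Fin n₂ → Momentum) :
    ‖phase F G ε p - phase F G 0 p‖ ≤ (n₁ + n₂ : ℝ) * |ε| := by
  have h : ∀ (A : FreeField r d) (q : Momentum),
      ‖minkowskiCLM (A.energy ε q) q - minkowskiCLM (A.energy 0 q) q‖ ≤ |ε| := fun A q => by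
    rw [minkowskiCLM_sub]
    refine (norm_minkowskiCLM_le _ _).trans ?_
    simpa using A.abs_energy_sub_le ε q
  have e : phase F G ε p - phase F G 0 p =
      (∑ j, (minkowskiCLM ((G j).energy ε (p (.inr j))) (p (.inr j)) -
        minkowskiCLM ((G j).energy 0 (p (.inr j))) (p (.inr j)))).comp
          (ContinuousLinearMap.snd ℝ SpaceTime SpaceTime) -
      (∑ i, (minkowskiCLM ((F i).energy ε (p (.inl i))) (p (.inl i)) -
        minkowskiCLM ((F i).energy 0 (p (.inl i))) (p (.inl i)))).comp
          (ContinuousLinearMap.fst ℝ SpaceTime SpaceTime) := by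
    rw [Finset.sum_sub_distrib, Finset.sum_sub_distrib, ContinuousLinearMap.sub_comp,
      ContinuousLinearMap.sub_comp, phase, phase]
    abel
  rw [e]
  refine (norm_comp_snd_sub_comp_fst_le _ _).trans ?_
  refine (add_le_add (norm_sum_le_of_le _ fun j _ => h _ _)
    (norm_sum_le_of_le _ fun i _ => h _ _)).trans_eq ?_
  simp only [Finset.sum_const, Finset.card_univ, Fintype.card_fin, nsmul_eq_mul]
  ring

theorem continuous_phase (ε : ℝ) : Continuous (phase F G ε) := by
  have h : ∀ (A : FreeField r d) (i : Fin n₁ ⊕ Fin n₂),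
      Continuous fun p : Fin n₁ ⊕ Fin n₂ → Momentum =>
        minkowskiCLM (A.energy ε (p i)) (p i) := fun A i => by
    have := A.continuous_energy ε
    unfold minkowskiCLM
    fun_prop
  exact ((continuous_finsetSum _ fun j _ => h _ _).clm_comp continuous_const).sub
    ((continuous_finsetSum _ fun i _ => h _ _).clm_comp continuous_const)

/-- The amplitudes of the non contracted fields, at fixed components and spin indices. -/
def amplitude (a : Fin n₁ → Fin d) (b : Fin n₂ → Fin d) (s : Fin n₁ ⊕ Fin n₂ → Fin r) :
    Fin n₁ ⊕ Fin n₂ → Momentum → ℂ :=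
  Sum.elim (fun i => (F i).u (s (.inl i)) (a i)) (fun j => (G j).v (s (.inr j)) (b j))

theorem amplitude_isMultiplier (a : Fin n₁ → Fin d) (b : Fin n₂ → Fin d)
    (s : Fin n₁ ⊕ Fin n₂ → Fin r) (i : Fin n₁ ⊕ Fin n₂) :
    IsMultiplier (singleParticleSpace (masses F G i)) (amplitude F G a b s i) := by
  cases i with
  | inl i => exact (F i).u_multiplier _ _
  | inr j => exact (G j).v_multiplier _ _

variable {F G}

/-- The part of the integrand of the product of the plane waves which does not depend on the
space-time points. -/
def coefficient (a : Fin n₁ → Fin d) (b : Fin n₂ → Fin d) (ξ : ParticleSpace F G)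
    (s : Fin n₁ ⊕ Fin n₂ → Fin r) (p : Fin n₁ ⊕ Fin n₂ → Momentum) : ℂ :=
  (∏ i, amplitude F G a b s i (p i)) *
    (ξ : 𝓢(Fin n₁ ⊕ Fin n₂ → Momentum, (Fin n₁ ⊕ Fin n₂ → Fin r) → ℂ)) p s

theorem waveIntegrand_eq (ε : ℝ) (a : Fin n₁ → Fin d) (b : Fin n₂ → Fin d)
    (ξ : ParticleSpace F G) (z : SpaceTime × SpaceTime) (s : Fin n₁ ⊕ Fin n₂ → Fin r)
    (p : Fin n₁ ⊕ Fin n₂ → Momentum) :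
    waveIntegrand ε F G a b ξ z s p =
      coefficient a b ξ s p * planeWave (phase F G ε p) z := by
  simp only [waveIntegrand, coefficient, planeWave, phase_apply, amplitude, FreeField.kernel01,
    FreeField.kernel10, Fintype.prod_sum_type, Sum.elim_inl, Sum.elim_inr,
    Finset.prod_mul_distrib, ← Complex.exp_sum]
  rw [Complex.ofReal_sub, mul_sub, sub_eq_neg_add, Complex.exp_add, Complex.ofReal_sum,
    Complex.ofReal_sum, Finset.mul_sum, Finset.mul_sum, ← Finset.sum_neg_distrib]
  ring

theorem measurable_coefficient (a : Fin n₁ → Fin d) (b : Fin n₂ → Fin d) (ξ : ParticleSpace F G)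
    (s : Fin n₁ ⊕ Fin n₂ → Fin r) : Measurable (coefficient a b ξ s) := by
  have h : Continuous fun p => (ξ : 𝓢(Fin n₁ ⊕ Fin n₂ → Momentum,
      (Fin n₁ ⊕ Fin n₂ → Fin r) → ℂ)) p s :=
    (continuous_apply s).comp (SchwartzMap.continuous _)
  exact (Finset.measurable_prod _ fun i _ =>
    (amplitude_isMultiplier F G a b s i).measurable.comp (measurable_pi_apply i)).mul h.measurable

end NonContracted

/-! ### Estimates of the products of plane waves -/

section Wave

open MeasureTheory

variable {n₁ n₂ : ℕ}

/-- An integrable power of `1 + |p|` on the space of all momenta. -/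
def momentumDecay (ι : Type) [Fintype ι] (p : ι → Momentum) : ℝ :=
  ((1 + ‖p‖) ^ (Module.finrank ℝ (ι → Momentum) + 1))⁻¹

theorem momentumDecay_nonneg {ι : Type} [Fintype ι] (p : ι → Momentum) :
    0 ≤ momentumDecay ι p := by
  unfold momentumDecay; positivity

theorem integrable_momentumDecay (ι : Type) [Fintype ι] : Integrable (momentumDecay ι) := by
  refine (integrable_one_add_norm (E := ι → Momentum) (μ := volume)
    (r := (Module.finrank ℝ (ι → Momentum) + 1 : ℕ)) (by push_cast; linarith)).congr
    (.of_forall fun p => ?_)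
  simp only [momentumDecay]
  rw [Real.rpow_neg (by positivity), Real.rpow_natCast]

variable (F : Fin n₁ → FreeField r d) (G : Fin n₂ → FreeField r d)

/-- The coefficient times any power of `1 + |p|` is dominated by an integrable function of the
momenta and a norm of the test function, uniformly in the components and spin indices. -/
theorem exists_norm_coefficient_mul_le (K : ℕ) : ∃ (k : ℕ) (C : ℝ), 0 ≤ C ∧
    ∀ (a : Fin n₁ → Fin d) (b : Fin n₂ → Fin d) (s : Fin n₁ ⊕ Fin n₂ → Fin r)
      (ξ : ParticleSpace F G) (p : Fin n₁ ⊕ Fin n₂ → Momentum),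
      ‖coefficient a b ξ s p‖ * (1 + ‖p‖) ^ K ≤
        C * schwartzNorm k (ξ : 𝓢(Fin n₁ ⊕ Fin n₂ → Momentum, (Fin n₁ ⊕ Fin n₂ → Fin r) → ℂ)) *
          momentumDecay _ p := by
  choose k C hC h using fun x : (Fin n₁ → Fin d) × (Fin n₂ → Fin d) × (Fin n₁ ⊕ Fin n₂ → Fin r) =>
    exists_norm_prod_multiplier_mul_le (r := r) (amplitude_isMultiplier F G x.1 x.2.1 x.2.2)
      (K + (Module.finrank ℝ (Fin n₁ ⊕ Fin n₂ → Momentum) + 1))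
  refine ⟨Finset.univ.sup k, ∑ x, C x, Finset.sum_nonneg fun x _ => hC x, fun a b s ξ p => ?_⟩
  have hx := h (a, b, s) ξ p
  have h1 : ‖(ξ : 𝓢(Fin n₁ ⊕ Fin n₂ → Momentum, (Fin n₁ ⊕ Fin n₂ → Fin r) → ℂ)) p s‖ ≤
      ‖(ξ : 𝓢(Fin n₁ ⊕ Fin n₂ → Momentum, (Fin n₁ ⊕ Fin n₂ → Fin r) → ℂ)) p‖ :=
    norm_le_pi_norm _ s
  rw [momentumDecay, ← div_eq_mul_inv, le_div_iff₀ (by positivity), mul_assoc, ← pow_add,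
    coefficient, norm_mul]
  refine le_trans ?_ (hx.trans ?_)
  · gcongr
  · refine mul_le_mul (Finset.single_le_sum (fun x _ => hC x) (Finset.mem_univ _))
      (schwartzNorm_mono (Finset.le_sup (Finset.mem_univ _)) _) (apply_nonneg _ _)
      (Finset.sum_nonneg fun x _ => hC x)

variable {F G}

section Integrand

variable (ε : ℝ) (a : Fin n₁ → Fin d) (b : Fin n₂ → Fin d) (ξ : ParticleSpace F G)
  (s : Fin n₁ ⊕ Fin n₂ → Fin r)

theorem waveIntegrand_eq_smul (p : Fin n₁ ⊕ Fin n₂ → Momentum) :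
    (fun z => waveIntegrand ε F G a b ξ z s p) =
      coefficient a b ξ s p • planeWave (phase F G ε p) := by
  ext z
  rw [waveIntegrand_eq, Pi.smul_apply, smul_eq_mul]

theorem contDiff_waveIntegrand (p : Fin n₁ ⊕ Fin n₂ → Momentum) :
    ContDiff ℝ (⊤ : ℕ∞) (fun z => waveIntegrand ε F G a b ξ z s p) := by
  rw [waveIntegrand_eq_smul]
  exact contDiff_const.smul (contDiff_planeWave _ _)

theorem iteratedFDeriv_waveIntegrand (n : ℕ) (z : SpaceTime × SpaceTime)
    (p : Fin n₁ ⊕ Fin n₂ → Momentum) :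
    iteratedFDeriv ℝ n (fun z => waveIntegrand ε F G a b ξ z s p) z =
      coefficient a b ξ s p • iteratedFDeriv ℝ n (planeWave (phase F G ε p)) z := by
  rw [waveIntegrand_eq_smul, iteratedFDeriv_const_smul_apply (contDiff_planeWave _ _).contDiffAt]

theorem aestronglyMeasurable_iteratedFDeriv_waveIntegrand (n : ℕ) (z : SpaceTime × SpaceTime) :
    AEStronglyMeasurable
      (fun p => iteratedFDeriv ℝ n (fun z => waveIntegrand ε F G a b ξ z s p) z) := by
  simp_rw [iteratedFDeriv_waveIntegrand]
  exact (measurable_coefficient a b ξ s).aestronglyMeasurable.smul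
    ((continuous_iteratedFDeriv_planeWave n z).comp (continuous_phase F G ε)).aestronglyMeasurable

end Integrand

variable (F G)

/-- The derivatives of the integrands are dominated by integrable functions of the momenta, which do
not depend on the space-time points and are bounded by a norm of the test function. -/
theorem exists_norm_iteratedFDeriv_waveIntegrand_le (ε : ℝ) (K : ℕ) : ∃ (k : ℕ) (C : ℝ), 0 ≤ C ∧
    ∀ (a : Fin n₁ → Fin d) (b : Fin n₂ → Fin d) (s : Fin n₁ ⊕ Fin n₂ → Fin r)
      (ξ : ParticleSpace F G) (p : Fin n₁ ⊕ Fin n₂ → Momentum), ∀ n ≤ K, ∀ z,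
      ‖iteratedFDeriv ℝ n (fun z => waveIntegrand ε F G a b ξ z s p) z‖ ≤
        C * schwartzNorm k (ξ : 𝓢(Fin n₁ ⊕ Fin n₂ → Momentum, (Fin n₁ ⊕ Fin n₂ → Fin r) → ℂ)) *
          momentumDecay _ p := by
  obtain ⟨k, C, hC, h⟩ := exists_norm_coefficient_mul_le F G K
  obtain ⟨c, hc, hphase⟩ := exists_norm_phase_zero_le F G
  -- the norm of the phase is at most `B (1 + |p|)`
  set B : ℝ := 1 + c + (n₁ + n₂) * |ε| with hB
  have hB1 : 1 ≤ B := by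
    have : (0 : ℝ) ≤ (n₁ + n₂) * |ε| := by positivity
    linarith
  refine ⟨k, B ^ K * C, by positivity, fun a b s ξ p n hn z => ?_⟩
  have hL : ‖phase F G ε p‖ ≤ B * (1 + ‖p‖) := by
    have h1 := norm_add_le (phase F G ε p - phase F G 0 p) (phase F G 0 p)
    rw [sub_add_cancel] at h1
    have h2 := norm_phase_sub_le F G ε p
    have h3 : 0 ≤ (n₁ + n₂ : ℝ) * |ε| * ‖p‖ := by positivity
    nlinarith [hphase p, norm_nonneg p]
  rw [iteratedFDeriv_waveIntegrand, norm_smul]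
  have hp1 : 1 ≤ B * (1 + ‖p‖) := by nlinarith [norm_nonneg p]
  calc ‖coefficient a b ξ s p‖ * ‖iteratedFDeriv ℝ n (planeWave (phase F G ε p)) z‖
      ≤ ‖coefficient a b ξ s p‖ * (B * (1 + ‖p‖)) ^ K := by
        gcongr
        exact (norm_iteratedFDeriv_planeWave_le _ _ _).trans
          ((pow_le_pow_left₀ (norm_nonneg _) hL n).trans (pow_le_pow_right₀ hp1 hn))
    _ = B ^ K * (‖coefficient a b ξ s p‖ * (1 + ‖p‖) ^ K) := by rw [mul_pow]; ring
    _ ≤ B ^ K * _ := mul_le_mul_of_nonneg_left (h a b s ξ p) (by positivity)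
    _ = _ := by ring

/-- The difference of the integrands for the regularized and the massless energies, of order `ε`. -/
theorem exists_norm_iteratedFDeriv_waveIntegrand_sub_le (K : ℕ) : ∃ k : ℕ, ∀ ε₀ : ℝ, 0 < ε₀ →
    ∃ C : ℝ, 0 ≤ C ∧ ∀ ε : ℝ, |ε| ≤ ε₀ →
    ∀ (a : Fin n₁ → Fin d) (b : Fin n₂ → Fin d) (s : Fin n₁ ⊕ Fin n₂ → Fin r)
      (ξ : ParticleSpace F G) (p : Fin n₁ ⊕ Fin n₂ → Momentum), ∀ n ≤ K, ∀ z,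
      ‖iteratedFDeriv ℝ n (fun z => waveIntegrand ε F G a b ξ z s p) z -
          iteratedFDeriv ℝ n (fun z => waveIntegrand 0 F G a b ξ z s p) z‖ ≤
        |ε| * C * (1 + ‖z‖) *
          schwartzNorm k (ξ : 𝓢(Fin n₁ ⊕ Fin n₂ → Momentum, (Fin n₁ ⊕ Fin n₂ → Fin r) → ℂ)) *
            momentumDecay _ p := by
  obtain ⟨k, C, hC, h⟩ := exists_norm_coefficient_mul_le F G K
  obtain ⟨c, hc, hphase⟩ := exists_norm_phase_zero_le F G
  refine ⟨k, fun ε₀ hε₀ => ?_⟩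
  -- `B (1 + |p|)` bounds the phase at zero and its change for all `|ε| ≤ ε₀`
  set B : ℝ := 1 + c + (n₁ + n₂) * ε₀ with hB
  have hB1 : 1 ≤ B := by
    have : (0 : ℝ) ≤ (n₁ + n₂) * ε₀ := by positivity
    linarith
  refine ⟨(n₁ + n₂) * B ^ K * C, by positivity, fun ε hε a b s ξ p n hn z => ?_⟩
  have hd := norm_phase_sub_le F G ε p
  have hL : 1 + ‖phase F G 0 p‖ + ‖phase F G ε p - phase F G 0 p‖ ≤ B * (1 + ‖p‖) := by
    have h2 : (n₁ + n₂ : ℝ) * |ε| ≤ (n₁ + n₂) * ε₀ := by gcongr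
    have h3 : 0 ≤ (n₁ + n₂ : ℝ) * ε₀ * ‖p‖ := by positivity
    nlinarith [hphase p, norm_nonneg p]
  have hp1 : 1 ≤ B * (1 + ‖p‖) := by nlinarith [norm_nonneg p]
  rw [iteratedFDeriv_waveIntegrand, iteratedFDeriv_waveIntegrand, ← smul_sub,
    ← iteratedFDeriv_sub_apply (contDiff_planeWave _ _).contDiffAt
      (contDiff_planeWave _ _).contDiffAt, norm_smul]
  calc ‖coefficient a b ξ s p‖ *
        ‖iteratedFDeriv ℝ n (planeWave (phase F G ε p) - planeWave (phase F G 0 p)) z‖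
      ≤ ‖coefficient a b ξ s p‖ *
          (((n₁ + n₂) * |ε|) * (1 + ‖z‖) * (B * (1 + ‖p‖)) ^ K) := by
        refine mul_le_mul_of_nonneg_left
          ((norm_iteratedFDeriv_planeWave_sub_le _ _ _ _).trans ?_) (norm_nonneg _)
        gcongr
        exact (pow_le_pow_left₀ (by positivity) hL n).trans (pow_le_pow_right₀ hp1 hn)
    _ = |ε| * (n₁ + n₂) * (1 + ‖z‖) * B ^ K * (‖coefficient a b ξ s p‖ * (1 + ‖p‖) ^ K) := by
        rw [mul_pow]; ring
    _ ≤ |ε| * (n₁ + n₂) * (1 + ‖z‖) * B ^ K * _ :=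
        mul_le_mul_of_nonneg_left (h a b s ξ p) (by positivity)
    _ = _ := by ring

variable {F G}

section Integral

variable (ε : ℝ) (a : Fin n₁ → Fin d) (b : Fin n₂ → Fin d) (ξ : ParticleSpace F G)

theorem integrable_iteratedFDeriv_waveIntegrand (s : Fin n₁ ⊕ Fin n₂ → Fin r) (n : ℕ)
    (z : SpaceTime × SpaceTime) :
    Integrable fun p => iteratedFDeriv ℝ n (fun z => waveIntegrand ε F G a b ξ z s p) z := by
  obtain ⟨k, C, -, h⟩ := exists_norm_iteratedFDeriv_waveIntegrand_le F G ε n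
  exact ((integrable_momentumDecay _).const_mul _).mono'
    (aestronglyMeasurable_iteratedFDeriv_waveIntegrand ε a b ξ s n z)
    (.of_forall fun p => h a b s ξ p n le_rfl z)

theorem integrable_waveIntegrand (z : SpaceTime × SpaceTime) (s : Fin n₁ ⊕ Fin n₂ → Fin r) :
    Integrable (waveIntegrand ε F G a b ξ z s) := by
  have h := integrable_iteratedFDeriv_waveIntegrand ε a b ξ s 0 z
  refine (integrable_norm_iff ?_).1 ?_
  · simp_rw [funext (waveIntegrand_eq ε a b ξ z s)]
    exact (measurable_coefficient a b ξ s).aestronglyMeasurable.mul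
      ((Complex.continuous_exp.comp (continuous_const.mul (Complex.continuous_ofReal.comp
        ((ContinuousLinearMap.apply ℝ ℝ z).continuous.comp
          (continuous_phase F G ε))))).aestronglyMeasurable)
  · simpa only [norm_iteratedFDeriv_zero] using h.norm

theorem contDiff_and_iteratedFDeriv_integral_waveIntegrand (s : Fin n₁ ⊕ Fin n₂ → Fin r) :
    ContDiff ℝ (⊤ : ℕ∞) (fun z => ∫ p, waveIntegrand ε F G a b ξ z s p) ∧
    ∀ n, iteratedFDeriv ℝ n (fun z => ∫ p, waveIntegrand ε F G a b ξ z s p) =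
      fun z => ∫ p, iteratedFDeriv ℝ n (fun z => waveIntegrand ε F G a b ξ z s p) z := by
  choose k C _ h using exists_norm_iteratedFDeriv_waveIntegrand_le F G ε
  have hm := aestronglyMeasurable_iteratedFDeriv_waveIntegrand ε a b ξ s
  have hi := fun n : ℕ => (integrable_momentumDecay (Fin n₁ ⊕ Fin n₂)).const_mul
    (C n * schwartzNorm (k n) (ξ : 𝓢(Fin n₁ ⊕ Fin n₂ → Momentum,
      (Fin n₁ ⊕ Fin n₂ → Fin r) → ℂ)))
  exact ⟨contDiff_integral (contDiff_waveIntegrand ε a b ξ s) hm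
      (fun n p z => h n a b s ξ p n le_rfl z) hi,
    iteratedFDeriv_integral (contDiff_waveIntegrand ε a b ξ s) hm
      (fun n p z => h n a b s ξ p n le_rfl z) hi⟩

theorem contDiff_waveProduct : ContDiff ℝ (⊤ : ℕ∞) (waveProduct ε F G a b ξ) :=
  ContDiff.sum fun s _ => (contDiff_and_iteratedFDeriv_integral_waveIntegrand ε a b ξ s).1

theorem iteratedFDeriv_waveProduct (n : ℕ) (z : SpaceTime × SpaceTime) :
    iteratedFDeriv ℝ n (waveProduct ε F G a b ξ) z =
      ∑ s, ∫ p, iteratedFDeriv ℝ n (fun z => waveIntegrand ε F G a b ξ z s p) z := by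
  have h := contDiff_and_iteratedFDeriv_integral_waveIntegrand ε a b ξ
  have e : waveProduct ε F G a b ξ = fun z => ∑ s, ∫ p, waveIntegrand ε F G a b ξ z s p := rfl
  rw [e, iteratedFDeriv_fun_sum_apply fun s _ =>
    ((h s).1.of_le (by exact_mod_cast le_top)).contDiffAt]
  exact Finset.sum_congr rfl fun s _ => congrFun ((h s).2 n) z

end Integral

variable (F G)

theorem exists_norm_iteratedFDeriv_waveProduct_le (ε : ℝ) (K : ℕ) : ∃ (k : ℕ) (C : ℝ), 0 ≤ C ∧
    ∀ (a : Fin n₁ → Fin d) (b : Fin n₂ → Fin d) (ξ : ParticleSpace F G), ∀ n ≤ K, ∀ z,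
      ‖iteratedFDeriv ℝ n (waveProduct ε F G a b ξ) z‖ ≤
        C * schwartzNorm k
          (ξ : 𝓢(Fin n₁ ⊕ Fin n₂ → Momentum, (Fin n₁ ⊕ Fin n₂ → Fin r) → ℂ)) := by
  obtain ⟨k, C, hC, h⟩ := exists_norm_iteratedFDeriv_waveIntegrand_le F G ε K
  have hJ : 0 ≤ ∫ p, momentumDecay (Fin n₁ ⊕ Fin n₂) p := integral_nonneg momentumDecay_nonneg
  refine ⟨k, Fintype.card (Fin n₁ ⊕ Fin n₂ → Fin r) * (C * ∫ p, momentumDecay _ p),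
    by positivity, fun a b ξ n hn z => ?_⟩
  rw [iteratedFDeriv_waveProduct]
  refine (norm_sum_le_of_le _ fun s _ => norm_integral_le_of_norm_le
    ((integrable_momentumDecay _).const_mul _)
    (.of_forall fun p => h a b s ξ p n hn z)).trans_eq ?_
  rw [integral_const_mul, Finset.sum_const, Finset.card_univ, nsmul_eq_mul]
  ring

theorem exists_norm_iteratedFDeriv_waveProduct_sub_le (K : ℕ) : ∃ k : ℕ, ∀ ε₀ : ℝ, 0 < ε₀ →
    ∃ C : ℝ, 0 ≤ C ∧ ∀ ε : ℝ, |ε| ≤ ε₀ →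
    ∀ (a : Fin n₁ → Fin d) (b : Fin n₂ → Fin d) (ξ : ParticleSpace F G), ∀ n ≤ K, ∀ z,
      ‖iteratedFDeriv ℝ n (waveProduct ε F G a b ξ - waveProduct 0 F G a b ξ) z‖ ≤
        |ε| * C * (1 + ‖z‖) * schwartzNorm k
          (ξ : 𝓢(Fin n₁ ⊕ Fin n₂ → Momentum, (Fin n₁ ⊕ Fin n₂ → Fin r) → ℂ)) := by
  obtain ⟨k, h⟩ := exists_norm_iteratedFDeriv_waveIntegrand_sub_le F G K
  refine ⟨k, fun ε₀ hε₀ => ?_⟩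
  obtain ⟨C, hC, h⟩ := h ε₀ hε₀
  have hJ : 0 ≤ ∫ p, momentumDecay (Fin n₁ ⊕ Fin n₂) p := integral_nonneg momentumDecay_nonneg
  refine ⟨Fintype.card (Fin n₁ ⊕ Fin n₂ → Fin r) * (C * ∫ p, momentumDecay _ p),
    by positivity, fun ε hε a b ξ n hn z => ?_⟩
  rw [iteratedFDeriv_sub_apply
    ((contDiff_waveProduct ε a b ξ).of_le (by exact_mod_cast le_top)).contDiffAt
    ((contDiff_waveProduct 0 a b ξ).of_le (by exact_mod_cast le_top)).contDiffAt,
    iteratedFDeriv_waveProduct, iteratedFDeriv_waveProduct, ← Finset.sum_sub_distrib]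
  simp_rw [← fun s => integral_sub (integrable_iteratedFDeriv_waveIntegrand ε a b ξ s n z)
    (integrable_iteratedFDeriv_waveIntegrand 0 a b ξ s n z)]
  refine (norm_sum_le_of_le _ fun s _ => norm_integral_le_of_norm_le
    ((integrable_momentumDecay _).const_mul _)
    (.of_forall fun p => h ε hε a b s ξ p n hn z)).trans_eq ?_
  rw [integral_const_mul, Finset.sum_const, Finset.card_univ, nsmul_eq_mul]
  ring

variable {F G}

theorem hasTemperateGrowth_waveProduct (ε : ℝ) (a : Fin n₁ → Fin d) (b : Fin n₂ → Fin d)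
    (ξ : ParticleSpace F G) : (waveProduct ε F G a b ξ).HasTemperateGrowth := by
  refine ⟨contDiff_waveProduct ε a b ξ, fun n => ?_⟩
  obtain ⟨k, C, -, h⟩ := exists_norm_iteratedFDeriv_waveProduct_le F G ε n
  exact ⟨0, _, fun z => by simpa using h a b ξ n le_rfl z⟩

theorem waveProduct_add (ε : ℝ) (a : Fin n₁ → Fin d) (b : Fin n₂ → Fin d)
    (ξ η : ParticleSpace F G) :
    waveProduct ε F G a b (ξ + η) = waveProduct ε F G a b ξ + waveProduct ε F G a b η := by
  ext z
  simp only [waveProduct, Pi.add_apply, ← Finset.sum_add_distrib]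
  refine Finset.sum_congr rfl fun s _ => ?_
  rw [← integral_add (integrable_waveIntegrand ε a b ξ z s)
    (integrable_waveIntegrand ε a b η z s)]
  congr 1
  ext p
  simp [waveIntegrand, mul_add]

theorem waveProduct_smul (ε : ℝ) (a : Fin n₁ → Fin d) (b : Fin n₂ → Fin d) (c : ℂ)
    (ξ : ParticleSpace F G) :
    waveProduct ε F G a b (c • ξ) = c • waveProduct ε F G a b ξ := by
  ext z
  simp only [waveProduct, Pi.smul_apply, Finset.smul_sum, ← integral_smul]
  refine Finset.sum_congr rfl fun s _ => ?_
  congr 1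
  ext p
  simp only [waveIntegrand, Submodule.coe_smul, smul_apply, Pi.smul_apply, smul_eq_mul]
  ring

end Wave

/-! ### Schwartz norms of products -/

section Products

variable {D : Type*} [NormedAddCommGroup D] [NormedSpace ℝ D]

/-- A multiplier whose derivatives of order at most `K` grow at most linearly costs one power of the
weight. -/
theorem schwartzNorm_smulLeftCLM_le {g : D → ℂ} (hg : g.HasTemperateGrowth) {K : ℕ} {M : ℝ}
    (h : ∀ n ≤ K, ∀ z, ‖iteratedFDeriv ℝ n g z‖ ≤ M * (1 + ‖z‖)) (f : 𝓢(D, ℂ)) :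
    schwartzNorm K (SchwartzMap.smulLeftCLM ℂ g f) ≤
      2 ^ (K + 1) * M * schwartzNorm (K + 1) f := by
  have hM : 0 ≤ M := by simpa using (norm_nonneg _).trans (h 0 (Nat.zero_le K) 0)
  set S := schwartzNorm (K + 1) f with hS
  have hS0 : 0 ≤ S := apply_nonneg _ _
  refine schwartzNorm_le (by positivity) fun j hj l hl z => ?_
  have e : ⇑(SchwartzMap.smulLeftCLM ℂ g f) = fun x => g x * f x := by
    rw [SchwartzMap.smulLeftCLM_apply hg]; rfl
  rw [e]
  have hmul := norm_iteratedFDeriv_mul_le (hg.1.of_le (by exact_mod_cast le_top))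
    ((f.smooth ⊤).of_le (by exact_mod_cast le_top)) z (le_refl (l : WithTop ℕ∞))
  calc ‖z‖ ^ j * ‖iteratedFDeriv ℝ l (fun x => g x * f x) z‖
      ≤ ‖z‖ ^ j * ∑ i ∈ Finset.range (l + 1), (l.choose i : ℝ) * ‖iteratedFDeriv ℝ i g z‖ *
          ‖iteratedFDeriv ℝ (l - i) f z‖ := by gcongr
    _ = ∑ i ∈ Finset.range (l + 1), (l.choose i : ℝ) * (‖iteratedFDeriv ℝ i g z‖ *
          (‖z‖ ^ j * ‖iteratedFDeriv ℝ (l - i) f z‖)) := by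
        rw [Finset.mul_sum]
        exact Finset.sum_congr rfl fun i _ => by ring
    _ ≤ ∑ i ∈ Finset.range (l + 1), (l.choose i : ℝ) * (M * (2 * S)) := by
        refine Finset.sum_le_sum fun i hi => ?_
        have hi' : i ≤ K := (Nat.lt_succ_iff.1 (Finset.mem_range.1 hi)).trans hl
        have h1 := le_schwartzNorm (k := K + 1) (by omega : j ≤ K + 1)
          (by omega : l - i ≤ K + 1) f z
        have h2 := le_schwartzNorm (k := K + 1) (by omega : j + 1 ≤ K + 1)
          (by omega : l - i ≤ K + 1) f z
        refine mul_le_mul_of_nonneg_left ?_ (Nat.cast_nonneg _)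
        calc ‖iteratedFDeriv ℝ i g z‖ * (‖z‖ ^ j * ‖iteratedFDeriv ℝ (l - i) f z‖)
            ≤ M * (1 + ‖z‖) * (‖z‖ ^ j * ‖iteratedFDeriv ℝ (l - i) f z‖) := by
              gcongr
              exact h i hi' z
          _ = M * (‖z‖ ^ j * ‖iteratedFDeriv ℝ (l - i) f z‖ +
                ‖z‖ ^ (j + 1) * ‖iteratedFDeriv ℝ (l - i) f z‖) := by ring
          _ ≤ M * (2 * S) := by gcongr; linarith
    _ = 2 ^ l * (M * (2 * S)) := by
        rw [← Finset.sum_mul]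
        congr 1
        exact_mod_cast Nat.sum_range_choose l
    _ ≤ 2 ^ K * (M * (2 * S)) := by gcongr; norm_num
    _ = 2 ^ (K + 1) * M * S := by ring

theorem schwartzNorm_postcompCLM_proj_le {I : Type*} [Fintype I] (i : I) (K : ℕ)
    (χ : 𝓢(D, I → ℂ)) :
    schwartzNorm K (SchwartzMap.postcompCLM
      (ContinuousLinearMap.proj (R := ℂ) (φ := fun _ => ℂ) i) χ) ≤ schwartzNorm K χ := by
  refine schwartzNorm_le (apply_nonneg _ _) fun j hj l hl z => ?_
  refine le_trans ?_ (le_schwartzNorm hj hl χ z)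
  refine mul_le_mul_of_nonneg_left ?_ (by positivity)
  have h := ContinuousLinearMap.norm_iteratedFDeriv_comp_left
    (ContinuousLinearMap.proj (R := ℝ) (φ := fun _ : I => ℂ) i) (x := z) (n := l)
    (χ.smooth ⊤).contDiffAt (by exact_mod_cast le_top)
  have hn : ‖ContinuousLinearMap.proj (R := ℝ) (φ := fun _ : I => ℂ) i‖ ≤ 1 :=
    ContinuousLinearMap.opNorm_le_bound _ zero_le_one fun x => by
      rw [one_mul]; exact norm_le_pi_norm x i
  exact h.trans (mul_le_of_le_one_left (norm_nonneg _) hn)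

theorem norm_iteratedFDeriv_comp_continuousLinearMap_le {D' V : Type*} [NormedAddCommGroup D']
    [NormedSpace ℝ D'] [NormedAddCommGroup V] [NormedSpace ℝ V] (f : 𝓢(D', V)) (L : D →L[ℝ] D')
    (hL : ‖L‖ ≤ 1) (i : ℕ) (z : D) :
    ‖iteratedFDeriv ℝ i (fun z => f (L z)) z‖ ≤ ‖iteratedFDeriv ℝ i f (L z)‖ := by
  have h := L.iteratedFDeriv_comp_right (f.smooth ⊤) z (i := i) (by exact_mod_cast le_top)
  change ‖iteratedFDeriv ℝ i (⇑f ∘ ⇑L) z‖ ≤ _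
  rw [h]
  exact (ContinuousMultilinearMap.norm_compContinuousLinearMap_le _ _).trans
    (mul_le_of_le_one_right (norm_nonneg _)
      (Finset.prod_le_one (fun _ _ => norm_nonneg _) fun _ _ => hL))

theorem exists_schwartzNorm_componentTensor_le (I J : Type) [Fintype I] [Fintype J] (k : ℕ) :
    ∃ C : ℝ, 0 ≤ C ∧ ∀ (φ : 𝓢(SpaceTime, I → ℂ)) (ϕ : 𝓢(SpaceTime, J → ℂ)),
      schwartzNorm k (componentTensor φ ϕ) ≤ C * schwartzNorm k φ * schwartzNorm k ϕ := by
  refine ⟨‖outer I J‖ * 2 ^ (k + 1), mul_nonneg (outer I J).opNorm_nonneg (by positivity),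
    fun φ ϕ => ?_⟩
  have hB : 0 ≤ ‖outer I J‖ := (outer I J).opNorm_nonneg
  set S := schwartzNorm k φ with hS
  set S' := schwartzNorm k ϕ with hS'
  have hS0 : 0 ≤ S := apply_nonneg _ _
  have hS0' : 0 ≤ S' := apply_nonneg _ _
  refine schwartzNorm_le (by positivity) fun j hj l hl z => ?_
  have hf : ContDiff ℝ (⊤ : ℕ∞) (fun z : SpaceTime × SpaceTime => φ z.1) :=
    (φ.smooth ⊤).comp contDiff_fst
  have hg : ContDiff ℝ (⊤ : ℕ∞) (fun z : SpaceTime × SpaceTime => ϕ z.2) :=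
    (ϕ.smooth ⊤).comp contDiff_snd
  have hb := (outer I J).norm_iteratedFDeriv_le_of_bilinear hf hg z (n := l)
    (by exact_mod_cast le_top)
  have hz : ‖z‖ ^ j ≤ ‖z.1‖ ^ j + ‖z.2‖ ^ j := by
    rw [Prod.norm_def]
    rcases le_total ‖z.1‖ ‖z.2‖ with h | h
    · rw [max_eq_right h]; exact le_add_of_nonneg_left (by positivity)
    · rw [max_eq_left h]; exact le_add_of_nonneg_right (by positivity)
  have hterm : ∀ i ∈ Finset.range (l + 1), ‖z‖ ^ j * ((l.choose i : ℝ) *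
      ‖iteratedFDeriv ℝ i (fun z : SpaceTime × SpaceTime => φ z.1) z‖ *
        ‖iteratedFDeriv ℝ (l - i) (fun z : SpaceTime × SpaceTime => ϕ z.2) z‖) ≤
      (l.choose i : ℝ) * (2 * S * S') := by
    intro i hi
    have hi' : i ≤ k := (Nat.lt_succ_iff.1 (Finset.mem_range.1 hi)).trans hl
    have h1 := norm_iteratedFDeriv_comp_continuousLinearMap_le φ
      (ContinuousLinearMap.fst ℝ SpaceTime SpaceTime) (ContinuousLinearMap.norm_fst_le _ _ _) i z
    have h2 := norm_iteratedFDeriv_comp_continuousLinearMap_le ϕ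
      (ContinuousLinearMap.snd ℝ SpaceTime SpaceTime) (ContinuousLinearMap.norm_snd_le _ _ _)
      (l - i) z
    have a1 := le_schwartzNorm hj hi' φ z.1
    have a2 := norm_iteratedFDeriv_le_schwartzNorm hi' φ z.1
    have b1 := le_schwartzNorm hj (show l - i ≤ k by omega) ϕ z.2
    have b2 := norm_iteratedFDeriv_le_schwartzNorm (show l - i ≤ k by omega) ϕ z.2
    calc _ ≤ (‖z.1‖ ^ j + ‖z.2‖ ^ j) * ((l.choose i : ℝ) * ‖iteratedFDeriv ℝ i φ z.1‖ *
          ‖iteratedFDeriv ℝ (l - i) ϕ z.2‖) := by gcongr; exacts [h1, h2]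
      _ = (l.choose i : ℝ) * ((‖z.1‖ ^ j * ‖iteratedFDeriv ℝ i φ z.1‖) *
            ‖iteratedFDeriv ℝ (l - i) ϕ z.2‖ + ‖iteratedFDeriv ℝ i φ z.1‖ *
            (‖z.2‖ ^ j * ‖iteratedFDeriv ℝ (l - i) ϕ z.2‖)) := by ring
      _ ≤ (l.choose i : ℝ) * (S * S' + S * S') := by gcongr
      _ = _ := by ring
  calc ‖z‖ ^ j * ‖iteratedFDeriv ℝ l (componentTensor φ ϕ) z‖
      ≤ ‖z‖ ^ j * _ := mul_le_mul_of_nonneg_left hb (by positivity)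
    _ = ‖outer I J‖ * ∑ i ∈ Finset.range (l + 1), ‖z‖ ^ j * ((l.choose i : ℝ) *
          ‖iteratedFDeriv ℝ i (fun z : SpaceTime × SpaceTime => φ z.1) z‖ *
          ‖iteratedFDeriv ℝ (l - i) (fun z : SpaceTime × SpaceTime => ϕ z.2) z‖) := by
        rw [mul_left_comm, Finset.mul_sum]
    _ ≤ ‖outer I J‖ * ∑ i ∈ Finset.range (l + 1), (l.choose i : ℝ) * (2 * S * S') :=
        mul_le_mul_of_nonneg_left (Finset.sum_le_sum hterm) hB
    _ = ‖outer I J‖ * (2 ^ l * (2 * S * S')) := by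
        rw [← Finset.sum_mul]
        congr 2
        exact_mod_cast Nat.sum_range_choose l
    _ ≤ ‖outer I J‖ * (2 ^ k * (2 * S * S')) := by gcongr; norm_num
    _ = _ := by ring

end Products

/-! ### The strong topologies -/

section Strong

variable {E : Type*} [AddCommGroup E] [Module ℂ E] [TopologicalSpace E]
  {D V : Type*} [NormedAddCommGroup D] [NormedSpace ℝ D] [NormedAddCommGroup V]
  [NormedSpace ℂ V] [NormedSpace ℝ V] [SMulCommClass ℝ ℂ V]

theorem continuous_schwartzNorm (k : ℕ) : Continuous (schwartzNorm (D := D) (V := V) k) := by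
  refine Seminorm.continuous_of_le (q := ∑ q ∈ Finset.Iic (k, k), schwartzSeminormFamily ℂ D V q)
    ?_ (Seminorm.finset_sup_le_sum _ _)
  exact (continuous_finsetSum (Finset.Iic (k, k)) fun q _ =>
    (schwartz_withSeminorms ℂ D V).continuous_seminorm q).congr fun f => (sum_apply _ _ _).symm

theorem exists_schwartzNorm_le_of_isVonNBounded {B : Set 𝓢(D, V)}
    (hB : Bornology.IsVonNBounded ℂ B) (k : ℕ) : ∃ R > 0, ∀ χ ∈ B, schwartzNorm k χ ≤ R := by
  obtain ⟨R, hR, h⟩ := ((schwartz_withSeminorms ℂ D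
    V).isVonNBounded_iff_finset_seminorm_bounded).1 hB (Finset.Iic (k, k))
  exact ⟨R, hR, fun χ hχ => (h χ hχ).le⟩

/-- A linear map into the strong dual of a Schwartz space is continuous, if it is given by a form
bounded by a continuous seminorm of the argument and a norm of the test function. -/
theorem continuous_of_norm_apply_le [IsTopologicalAddGroup E] (Φ : E →ₗ[ℂ] (𝓢(D, V) →L[ℂ] ℂ))
    {p : Seminorm ℂ E} (hp : Continuous p) {k : ℕ}
    (h : ∀ ξ χ, ‖Φ ξ χ‖ ≤ p ξ * schwartzNorm k χ) : Continuous Φ := by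
  refine continuous_of_continuousAt_zero Φ ?_
  rw [ContinuousAt, map_zero, (ContinuousLinearMap.hasBasis_nhds_zero_of_basis
    (Metric.nhds_basis_ball (α := ℂ) (x := 0))).tendsto_right_iff]
  rintro ⟨B, δ⟩ ⟨hB, hδ⟩
  obtain ⟨R, hR, hRB⟩ := exists_schwartzNorm_le_of_isVonNBounded hB k
  have ht : Filter.Tendsto (fun ξ => p ξ * R) (𝓝 0) (𝓝 0) := by
    have := (hp.mul_const R).tendsto 0
    simpa using this
  filter_upwards [ht.eventually_lt_const hδ] with ξ hξ χ hχ
  rw [mem_ball_zero_iff]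
  exact ((h ξ χ).trans (mul_le_mul_of_nonneg_left (hRB χ hχ) (apply_nonneg p ξ))).trans_lt hξ

/-- Forms which differ by `O(ε)`, relative to Schwartz norms of both arguments, converge
uniformly on bounded sets. -/
theorem tendsto_of_norm_sub_apply_le {D' V' : Type*} [NormedAddCommGroup D'] [NormedSpace ℝ D']
    [NormedAddCommGroup V'] [NormedSpace ℂ V'] [NormedSpace ℝ V'] [SMulCommClass ℝ ℂ V']
    (f : E →L[ℂ] 𝓢(D', V')) (κ : ℝ → (E →L[ℂ] (𝓢(D, V) →L[ℂ] ℂ))) {k l : ℕ} {C : ℝ}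
    (h : ∀ ε, 0 < ε → ε ≤ 1 → ∀ ξ χ,
      ‖κ ε ξ χ - κ 0 ξ χ‖ ≤ ε * C * schwartzNorm k (f ξ) * schwartzNorm l χ) :
    Filter.Tendsto κ (𝓝[>] 0) (𝓝 (κ 0)) := by
  rw [← tendsto_sub_nhds_zero_iff, (ContinuousLinearMap.hasBasis_nhds_zero_of_basis
    (ContinuousLinearMap.hasBasis_nhds_zero_of_basis
      (Metric.nhds_basis_ball (α := ℂ) (x := 0)))).tendsto_right_iff]
  rintro ⟨B', B, δ⟩ ⟨hB', hB, hδ⟩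
  obtain ⟨R, hR, hRB⟩ := exists_schwartzNorm_le_of_isVonNBounded hB l
  obtain ⟨R', hR', hRB'⟩ := exists_schwartzNorm_le_of_isVonNBounded (hB'.image f) k
  have ht : Filter.Tendsto (fun ε : ℝ => ε * |C| * R' * R) (𝓝[>] 0) (𝓝 0) := by
    have : Continuous fun ε : ℝ => ε * |C| * R' * R := by fun_prop
    simpa using (this.tendsto 0).mono_left nhdsWithin_le_nhds
  filter_upwards [ht.eventually_lt_const hδ, self_mem_nhdsWithin,
    mem_nhdsWithin_of_mem_nhds (Iic_mem_nhds zero_lt_one)] with ε hε (hε0 : 0 < ε) hε1 ξ hξ χ hχ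
  rw [mem_ball_zero_iff]
  refine lt_of_le_of_lt ?_ hε
  refine (h ε hε0 hε1 ξ χ).trans ?_
  gcongr
  · exact le_abs_self C
  · exact hRB' _ (Set.mem_image_of_mem f hξ)
  · exact hRB χ hχ

end Strong

/-! ### The product kernels -/

section Kernel

variable {n₁ n₂ : ℕ} {I J : Type} [Fintype I] [Fintype J]

theorem exists_norm_temperedDistribution_le
    (T : I × J → 𝓢'(SpaceTime × SpaceTime, ℂ)) : ∃ (K : ℕ) (C : ℝ), 0 ≤ C ∧
      ∀ ij f, ‖T ij f‖ ≤ C * schwartzNorm K f := by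
  choose k C hC h using fun ij => exists_le_schwartzNorm LinearMap.id Topology.IsInducing.id
    ((normSeminorm ℂ ℂ).comp
      ((T ij : 𝓢(SpaceTime × SpaceTime, ℂ) →L[ℂ] ℂ) : 𝓢(SpaceTime × SpaceTime, ℂ) →ₗ[ℂ] ℂ))
    (continuous_norm.comp (map_continuous (T ij)))
  refine ⟨Finset.univ.sup k, ∑ ij, C ij, Finset.sum_nonneg fun x _ => hC x, fun ij f => ?_⟩
  exact (h ij f).trans (mul_le_mul (Finset.single_le_sum (fun x _ => hC x) (Finset.mem_univ _))
    (schwartzNorm_mono (Finset.le_sup (Finset.mem_univ _)) _) (apply_nonneg _ _)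
    (Finset.sum_nonneg fun x _ => hC x))

/-- The distribution with the components `g^{ab} T^{ij}`, as a functional on test functions with
several components. -/
def productFunctional (T : I × J → 𝓢'(SpaceTime × SpaceTime, ℂ))
    (g : (Fin n₁ → Fin d) → (Fin n₂ → Fin d) → SpaceTime × SpaceTime → ℂ) :
    TestSpace I J n₁ n₂ d →L[ℂ] ℂ :=
  ∑ i : Components I n₁ d, ∑ j : Components J n₂ d,
    (T (i.1, j.1) : 𝓢(SpaceTime × SpaceTime, ℂ) →L[ℂ] ℂ) ∘L
      SchwartzMap.smulLeftCLM ℂ (g i.2 j.2) ∘L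
      SchwartzMap.postcompCLM (ContinuousLinearMap.proj (R := ℂ) (φ := fun _ => ℂ) (i, j))

theorem productFunctional_apply (T : I × J → 𝓢'(SpaceTime × SpaceTime, ℂ))
    (g : (Fin n₁ → Fin d) → (Fin n₂ → Fin d) → SpaceTime × SpaceTime → ℂ)
    (χ : TestSpace I J n₁ n₂ d) :
    productFunctional T g χ = ∑ i : Components I n₁ d, ∑ j : Components J n₂ d,
      T (i.1, j.1) (SchwartzMap.smulLeftCLM ℂ (g i.2 j.2) (SchwartzMap.postcompCLM
        (ContinuousLinearMap.proj (R := ℂ) (φ := fun _ => ℂ) (i, j)) χ)) := by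
  simp only [productFunctional, sum_apply]
  rfl

/-- The product depends continuously on the multipliers: bounds of finitely many of their
derivatives are passed on to the functional, with an order and a constant depending only on `T`. -/
theorem exists_norm_productFunctional_le (T : I × J → 𝓢'(SpaceTime × SpaceTime, ℂ)) :
    ∃ (K : ℕ) (C : ℝ), 0 ≤ C ∧
      ∀ (g : (Fin n₁ → Fin d) → (Fin n₂ → Fin d) → SpaceTime × SpaceTime → ℂ) (M : ℝ),
      (∀ a b, (g a b).HasTemperateGrowth) →
      (∀ a b, ∀ n ≤ K, ∀ z, ‖iteratedFDeriv ℝ n (g a b) z‖ ≤ M * (1 + ‖z‖)) →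
      ∀ χ : TestSpace I J n₁ n₂ d,
        ‖productFunctional T g χ‖ ≤ C * M * schwartzNorm (K + 1) χ := by
  obtain ⟨K, C, hC, h⟩ := exists_norm_temperedDistribution_le T
  refine ⟨K, Fintype.card (Components I n₁ d) * (Fintype.card (Components J n₂ d) *
    (C * 2 ^ (K + 1))), by positivity, fun g M hg hM χ => ?_⟩
  rw [productFunctional_apply]
  have hterm : ∀ (i : Components I n₁ d) (j : Components J n₂ d),
      ‖T (i.1, j.1) (SchwartzMap.smulLeftCLM ℂ (g i.2 j.2) (SchwartzMap.postcompCLM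
        (ContinuousLinearMap.proj (R := ℂ) (φ := fun _ => ℂ) (i, j)) χ))‖ ≤
        C * (2 ^ (K + 1) * M * schwartzNorm (K + 1) χ) := fun i j => by
    have hM0 : 0 ≤ M := by
      simpa using (norm_nonneg _).trans (hM i.2 j.2 0 (Nat.zero_le K) 0)
    refine (h _ _).trans (mul_le_mul_of_nonneg_left ?_ hC)
    refine (schwartzNorm_smulLeftCLM_le (hg _ _) (hM _ _) _).trans ?_
    exact mul_le_mul_of_nonneg_left (schwartzNorm_postcompCLM_proj_le _ _ _) (by positivity)
  refine (norm_sum_le_of_le _ fun i _ => norm_sum_le_of_le _ fun j _ => hterm i j).trans_eq ?_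
  simp only [Finset.sum_const, Finset.card_univ, nsmul_eq_mul]
  ring

variable (F : Fin n₁ → FreeField r d) (G : Fin n₂ → FreeField r d)
  (T : I × J → 𝓢'(SpaceTime × SpaceTime, ℂ))

/-- The kernel `κ_ε` as a linear map of the particle space into the distributions. -/
def productKernelLinear (ε : ℝ) : ParticleSpace F G →ₗ[ℂ] (TestSpace I J n₁ n₂ d →L[ℂ] ℂ) where
  toFun ξ := productFunctional T fun a b => waveProduct ε F G a b ξ
  map_add' ξ η := by
    ext χ
    simp only [productFunctional_apply, add_apply, ← Finset.sum_add_distrib]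
    refine Finset.sum_congr rfl fun i _ => Finset.sum_congr rfl fun j _ => ?_
    rw [waveProduct_add, SchwartzMap.smulLeftCLM_add (hasTemperateGrowth_waveProduct _ _ _ _)
      (hasTemperateGrowth_waveProduct _ _ _ _), add_apply, map_add]
  map_smul' c ξ := by
    ext χ
    simp only [productFunctional_apply, smul_apply, Finset.smul_sum, RingHom.id_apply]
    refine Finset.sum_congr rfl fun i _ => Finset.sum_congr rfl fun j _ => ?_
    rw [waveProduct_smul, SchwartzMap.smulLeftCLM_smul (hasTemperateGrowth_waveProduct _ _ _ _),
      smul_apply, map_smul]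

theorem continuous_productKernelLinear (ε : ℝ) : Continuous (productKernelLinear F G T ε) := by
  obtain ⟨K, C, hC, h⟩ := exists_norm_productFunctional_le (d := d) (n₁ := n₁) (n₂ := n₂) T
  obtain ⟨k, C', hC', h'⟩ := exists_norm_iteratedFDeriv_waveProduct_le F G ε K
  set c : NNReal := ⟨C * C', by positivity⟩
  refine continuous_of_norm_apply_le _ (p := c •
    (schwartzNorm k).comp (tensorSpace r (masses F G)).subtype) (k := K + 1) ?_ fun ξ χ => ?_
  · exact ((continuous_schwartzNorm k).comp continuous_subtype_val).const_smul c
  · refine (h _ (C' * schwartzNorm k (ξ : 𝓢(Fin n₁ ⊕ Fin n₂ → Momentum,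
      (Fin n₁ ⊕ Fin n₂ → Fin r) → ℂ))) (fun a b => hasTemperateGrowth_waveProduct ε a b ξ)
      (fun a b n hn z => ?_) χ).trans_eq ?_
    · refine (h' a b ξ n hn z).trans (le_mul_of_one_le_right
        (mul_nonneg hC' (apply_nonneg _ _)) ?_)
      linarith [norm_nonneg z]
    · change _ = C * C' * schwartzNorm k (ξ : 𝓢(Fin n₁ ⊕ Fin n₂ → Momentum,
        (Fin n₁ ⊕ Fin n₂ → Fin r) → ℂ)) * _
      ring

/-- The kernel `κ_ε`, continuous into the strong dual of the test functions. -/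
def productKernel (ε : ℝ) : ParticleSpace F G →L[ℂ] (TestSpace I J n₁ n₂ d →L[ℂ] ℂ) :=
  ⟨productKernelLinear F G T ε, continuous_productKernelLinear F G T ε⟩

theorem productKernel_apply (ε : ℝ) (ξ : ParticleSpace F G) :
    productKernel F G T ε ξ = productFunctional T fun a b => waveProduct ε F G a b ξ := rfl

theorem isProductKernel_productKernel (ε : ℝ) :
    IsProductKernel ε F G T (productKernel F G T ε) := fun ξ =>
  ⟨fun a b z s => integrable_waveIntegrand ε a b ξ z s,
    fun a b => hasTemperateGrowth_waveProduct ε a b ξ,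
    fun χ => by
      rw [productKernel_apply, productFunctional_apply]
      rfl⟩

theorem exists_norm_productKernel_sub_le : ∃ k l : ℕ, ∀ ε₀ : ℝ, 0 < ε₀ → ∃ C : ℝ, 0 ≤ C ∧
    ∀ ε, |ε| ≤ ε₀ → ∀ (ξ : ParticleSpace F G) (χ : TestSpace I J n₁ n₂ d),
      ‖productKernel F G T ε ξ χ - productKernel F G T 0 ξ χ‖ ≤ |ε| * C * schwartzNorm k
        (ξ : 𝓢(Fin n₁ ⊕ Fin n₂ → Momentum, (Fin n₁ ⊕ Fin n₂ → Fin r) → ℂ)) *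
          schwartzNorm l χ := by
  obtain ⟨K, C, hC, h⟩ := exists_norm_productFunctional_le (d := d) (n₁ := n₁) (n₂ := n₂) T
  obtain ⟨k, h'⟩ := exists_norm_iteratedFDeriv_waveProduct_sub_le F G K
  refine ⟨k, K + 1, fun ε₀ hε₀ => ?_⟩
  obtain ⟨C', hC', h'⟩ := h' ε₀ hε₀
  refine ⟨C * C', by positivity, fun ε hε ξ χ => ?_⟩
  have hw := fun ε a b => hasTemperateGrowth_waveProduct (F := F) (G := G) ε a b ξ
  have e : productKernel F G T ε ξ χ - productKernel F G T 0 ξ χ = productFunctional T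
      (fun a b => waveProduct ε F G a b ξ - waveProduct 0 F G a b ξ) χ := by
    simp only [productKernel_apply, productFunctional_apply, ← Finset.sum_sub_distrib]
    refine Finset.sum_congr rfl fun i _ => Finset.sum_congr rfl fun j _ => ?_
    rw [SchwartzMap.smulLeftCLM_sub (hw _ _ _) (hw _ _ _), sub_apply, map_sub]
  rw [e]
  refine (h _ (|ε| * C' * schwartzNorm k (ξ : 𝓢(Fin n₁ ⊕ Fin n₂ → Momentum,
      (Fin n₁ ⊕ Fin n₂ → Fin r) → ℂ))) (fun a b => (hw _ _ _).sub (hw _ _ _))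
      (fun a b n hn z => (h' ε hε a b ξ n hn z).trans_eq ?_) χ).trans_eq ?_ <;> ring

theorem masslessLimit : MasslessLimit F G T := by
  obtain ⟨k, l, h⟩ := exists_norm_productKernel_sub_le F G T
  refine ⟨productKernel F G T, fun ε _ => isProductKernel_productKernel F G T ε, ?_, ?_⟩
  · obtain ⟨C, -, hC⟩ := h 1 one_pos
    refine tendsto_of_norm_sub_apply_le (tensorSpace r (masses F G)).subtypeL _
      (k := k) (l := l) (C := C) fun ε h0 h1 ξ χ => ?_
    have := hC ε (by rwa [abs_of_pos h0]) ξ χ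
    rwa [abs_of_pos h0] at this
  · refine ⟨l, k, fun ε₀ hε₀ => ?_⟩
    obtain ⟨C, hC0, hC⟩ := h ε₀ hε₀
    obtain ⟨C', -, hC'⟩ := exists_schwartzNorm_componentTensor_le
      (Components I n₁ d) (Components J n₂ d) l
    refine ⟨C * C', fun ε h0 h1 φ ϕ ξ => ?_⟩
    have hb := hC ε (by rwa [abs_of_pos h0]) ξ (componentTensor φ ϕ)
    rw [abs_of_pos h0] at hb
    refine hb.trans ((mul_le_mul_of_nonneg_left (hC' φ ϕ)
      (mul_nonneg (mul_nonneg h0.le hC0) (apply_nonneg _ _))).trans_eq ?_)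
    ring

end Kernel

end PlaneWave

end

theorem mainTheorem5 (r d q' n₁ n₂ : ℕ)
    (A : Fin q' → PlaneWave.FreeField r d)
    (F : Fin n₁ → PlaneWave.FreeField r d) (G : Fin n₂ → PlaneWave.FreeField r d) :
    (∀ T : (Fin q' → Fin d) × (Fin q' → Fin d) →
        𝓢'(PlaneWave.SpaceTime × PlaneWave.SpaceTime, ℂ),
      PlaneWave.IsRetardedContraction A T → PlaneWave.MasslessLimit F G T) ∧
    (∀ (I J : Type) [Fintype I] [Fintype J]
        (T : I × J → 𝓢'(PlaneWave.SpaceTime × PlaneWave.SpaceTime, ℂ)),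
      PlaneWave.MasslessLimit F G T) :=
  ⟨fun T _ => PlaneWave.masslessLimit F G T, fun _ _ _ _ T => PlaneWave.masslessLimit F G T⟩
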